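/- A polynomial parametric MDP (pMDP) $\mathcal M$ consists of a finite set $S$ of states, an initial state, a finite set of actions with a non-empty set $\mathrm{Act}(s)$ of available actions in each state $s$, a finite set $X$ of parameters, and transition labels $\mathcal P(s,\alpha,s')\in\mathbb Q[X]$ for $\alpha\in\mathrm{Act}(s)$. It is simple if every label lies in $\{x,1-x\mid x\in X\}\cup\mathbb Q_{\ge 0}$ and $\sum_{s'}\mathcal P(s,\alpha,s')\equiv 1$ for all $s$ and $\alpha\in\mathrm{Act}(s)$. A valuation $v\colon X\to\mathbb R$ is well-defined if, for all $s$ and all $\alpha\in\mathrm{Act}(s)$, the numbers $\mathcal P(s,\alpha,s')[v]$ are non-negative and sum up to $1$ over $s'$; it then instantiates $\mathcal M$ to an MDP $\mathcal M[v]$. A transition $(s,\alpha,s')$ vanishes under $v$ if $\mathcal P(s,\alpha,s')\neq 0$ but $\mathcal P(s,\alpha,s')[v]=0$. A well-defined valuation is graph-preserving if no transition vanishes under it, and Boolean if all its values lie in $\{0,1\}$. A set of well-defined valuations is graph-consistent if the same transitions vanish under all its members, and maximally so if no proper superset is graph-consistent. For a set $R$ of well-defined valuations of $\mathcal M$, a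 set $T\subseteq S$ of target states, a quantifier $\mathcal Q\in\{\exists,\forall\}$, and a condition $\bowtie\lambda$ among $>0$ (positive), $<1$ (unsure), $\le 0$ (safety), $\ge 1$ (almost-sure), the qualitative reachability problem asks, for a given simple pMDP $\mathcal M$ and a given $T$, whether $$\exists v\in R\;\;\mathcal Q\,\sigma:\;\; \Pr\nolimits^{\sigma}_{\mathcal M[v]}(\lozenge T)\bowtie\lambda ,$$ where $\sigma$ ranges over the deterministic memoryless strategies and $\Pr^{\sigma}_{\mathcal M[v]}(\lozenge T)$ is the probability to eventually reach $T$ from the initial state. The pMDP is given explicitly, rational constants as fractions of binary-encoded integers. Theorem. The following problems for simple pMDPs are decidable in polynomial time: (1) for every $\mathcal Q$ and every one of the four conditions, the problem where $R$ is the set of graph-preserving valuations; (2) for every $\mathcal Q$, the positive reachability problem for any choice of sets $R=R(\mathcal M,T)$ of well-defined valuations that include all graph-preserving valuations (in particular for the set of all well-defined valuations); (3) for every fixed $K\in\mathbb N$, every $\mathcal Q$ and every one of the four conditions, the problem restricted to simple pMDPs with at most $K$ parameters, where $R$ is the set of well-defined, of graph-preserving, or of Boolean valuations. Moreover, for every simple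 pMDP with parameter set $X$, the set of well-defined valuations can be partitioned into at most $3^{|X|}$ non-empty maximally graph-consistent sets. -/

import Mathlib

namespace ParamMDP

open scoped ENNReal

noncomputable section

/-! ### Markov chains and Markov decision processes -/

/-- A finite discrete-time Markov chain. -/
structure MC (S : Type*) [Fintype S] where
  init : S
  P : S → S → ℝ
  nonneg : ∀ s s', 0 ≤ P s s'
  sum_one : ∀ s, ∑ s', P s s' = 1

/-- The finite paths `s₀ s₁ … sₙ` with `s₀ = s` that end in `T` and have no proper prefix
visiting `T`. -/
def MC.pathsTo {S : Type*} [Fintype S] (D : MC S) (s : S) (T : Set S) :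
    Set (Σ n : ℕ, Fin (n + 1) → S) :=
  {π | π.2 0 = s ∧ (∀ i : Fin π.1, D.P (π.2 i.castSucc) (π.2 i.succ) ≠ 0) ∧
    π.2 (Fin.last π.1) ∈ T ∧ ∀ i : Fin π.1, π.2 i.castSucc ∉ T}

/-- The mass of a finite path: the product of its transition probabilities. -/
def MC.pathMass {S : Type*} [Fintype S] (D : MC S) (π : Σ n : ℕ, Fin (n + 1) → S) : ℝ≥0∞ :=
  ∏ i : Fin π.1, ENNReal.ofReal (D.P (π.2 i.castSucc) (π.2 i.succ))

/-- The probability of eventually reaching `T` from the initial state. -/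
def MC.reachProb {S : Type*} [Fintype S] (D : MC S) (T : Set S) : ℝ≥0∞ :=
  ∑' π : D.pathsTo D.init T, D.pathMass π

/-- A finite Markov decision process. `Act s` is the set of actions available in `s`; the
transition function is partial, so the values `P s a s'` with `a ∉ Act s` carry no meaning. -/
structure MDP (S A : Type*) [Fintype S] where
  init : S
  Act : S → Set A
  act_nonempty : ∀ s, (Act s).Nonempty
  P : S → A → S → ℝ
  nonneg : ∀ s, ∀ a ∈ Act s, ∀ s', 0 ≤ P s a s'
  sum_one : ∀ s, ∀ a ∈ Act s, ∑ s', P s a s' = 1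

/-- Deterministic memoryless strategies. -/
def MDP.DMSched {S A : Type*} [Fintype S] (M : MDP S A) : Type _ :=
  {σ : S → A // ∀ s, σ s ∈ M.Act s}

/-- The Markov chain induced by a deterministic memoryless strategy. -/
def MDP.induced {S A : Type*} [Fintype S] (M : MDP S A) (σ : M.DMSched) : MC S where
  init := M.init
  P s s' := M.P s (σ.1 s) s'
  nonneg s s' := M.nonneg s _ (σ.2 s) s'
  sum_one s := M.sum_one s _ (σ.2 s)

/-! ### Parametric Markov decision processes -/

/-- A polynomial parametric MDP with states `S`, actions `A` and parameters `X`. As for MDPs, the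
values `P s a s'` with `a ∉ Act s` carry no meaning. -/
structure PMDP (S A X : Type*) where
  init : S
  Act : S → Set A
  act_nonempty : ∀ s, (Act s).Nonempty
  P : S → A → S → MvPolynomial X ℚ

namespace PMDP

variable {S A X : Type*} [Fintype S] (M : PMDP S A X)

/-- A pMDP is simple if all its transitions are labelled by `x`, by `1 - x` or by a non-negative
rational constant, and all its rows sum up to the constant polynomial `1`. -/
def IsSimple : Prop :=
  (∀ s, ∀ a ∈ M.Act s, ∀ s',
    (∃ x, M.P s a s' = MvPolynomial.X x) ∨ (∃ x, M.P s a s' = 1 - MvPolynomial.X x) ∨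
      ∃ q : ℚ, 0 ≤ q ∧ M.P s a s' = MvPolynomial.C q) ∧
  ∀ s, ∀ a ∈ M.Act s, ∑ s', M.P s a s' = 1

/-- The well-defined valuations. -/
def wdVal : Set (X → ℝ) :=
  {v | (∀ s, ∀ a ∈ M.Act s, ∀ s', 0 ≤ MvPolynomial.aeval v (M.P s a s')) ∧
    ∀ s, ∀ a ∈ M.Act s, ∑ s', MvPolynomial.aeval v (M.P s a s') = 1}

/-- The instantiation of a pMDP by a well-defined valuation. -/
def instantiate (v : X → ℝ) (hv : v ∈ M.wdVal) : MDP S A where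
  init := M.init
  Act := M.Act
  act_nonempty := M.act_nonempty
  P s a s' := MvPolynomial.aeval v (M.P s a s')
  nonneg := hv.1
  sum_one := hv.2

/-- The transitions that vanish under a valuation. -/
def vanishing (v : X → ℝ) : Set (S × A × S) :=
  {t | t.2.1 ∈ M.Act t.1 ∧ M.P t.1 t.2.1 t.2.2 ≠ 0 ∧
    MvPolynomial.aeval v (M.P t.1 t.2.1 t.2.2) = 0}

/-- The graph-preserving valuations. -/
def gpVal : Set (X → ℝ) := {v | v ∈ M.wdVal ∧ M.vanishing v = ∅}

/-- The Boolean valuations. -/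
def boolVal : Set (X → ℝ) := {v | v ∈ M.wdVal ∧ ∀ x, v x = 0 ∨ v x = 1}

/-- Graph-consistent sets of valuations. -/
def IsGraphConsistent (R : Set (X → ℝ)) : Prop :=
  R ⊆ M.wdVal ∧ ∀ v ∈ R, ∀ w ∈ R, M.vanishing v = M.vanishing w

/-- Maximally graph-consistent sets of valuations: no proper superset is graph-consistent. -/
def IsMaxGraphConsistent (R : Set (X → ℝ)) : Prop :=
  M.IsGraphConsistent R ∧ ∀ R', M.IsGraphConsistent R' → R ⊆ R' → R' = R

end PMDP

/-! ### The qualitative reachability problems -/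

/-- The three classes of valuations over which the parameters may range. -/
inductive ValClass
  | wellDefined
  | graphPreserving
  | boolean

/-- The set of valuations of a pMDP described by a class. -/
def PMDP.vals {S A X : Type*} [Fintype S] (M : PMDP S A X) : ValClass → Set (X → ℝ)
  | .wellDefined => M.wdVal
  | .graphPreserving => M.gpVal
  | .boolean => M.boolVal

/-- How strategies are quantified: existentially or universally. -/
inductive Quantifier
  | ex
  | all

/-- `Q.Holds p` means `Q σ, p σ`. -/
def Quantifier.Holds {α : Type*} : Quantifier → (α → Prop) → Prop
  | .ex, p => ∃ σ, p σ
  | .all, p => ∀ σ, p σ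

/-- The four qualitative conditions on a reachability probability. -/
inductive Qualitative
  | positive
  | unsure
  | safety
  | almostSure

/-- The comparison belonging to a qualitative condition. -/
def Qualitative.Holds : Qualitative → ℝ≥0∞ → Prop
  | .positive, p => p > 0
  | .unsure, p => p < 1
  | .safety, p => p ≤ 0
  | .almostSure, p => p ≥ 1

/-- The qualitative reachability question for the pMDP `M`, the target states `T` and the set `R`
of well-defined valuations: is there a valuation in `R` such that for some / for all deterministic
memoryless strategies the probability to reach `T` satisfies the condition `φ`? -/
def PMDP.Reach {S A X : Type*} [Fintype S] (M : PMDP S A X) (T : Set S) (R : Set (X → ℝ))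
    (Q : Quantifier) (φ : Qualitative) : Prop :=
  ∃ (v : X → ℝ) (hv : v ∈ M.wdVal), v ∈ R ∧
    Q.Holds fun σ : (M.instantiate v hv).DMSched =>
      φ.Holds (((M.instantiate v hv).induced σ).reachProb T)

/-! ### Instances and their encoding -/

/-- Syntax of the transition labels of a simple pMDP with `k` parameters: the rational constant
`a / b` (an arbitrary, possibly reducible fraction), the parameter `x`, or `1 - x`. -/
inductive Label (k : ℕ)
  | const (a : ℕ) (b : ℕ+)
  | param (x : Fin k)
  | coparam (x : Fin k)

/-- The polynomial denoted by a label. -/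
def Label.toPoly {k : ℕ} : Label k → MvPolynomial (Fin k) ℚ
  | .const a b => MvPolynomial.C ((a : ℚ) / ((b : ℕ) : ℚ))
  | .param x => MvPolynomial.X x
  | .coparam x => 1 - MvPolynomial.X x

/-- An instance of a reachability problem for simple pMDPs: an explicitly given simple pMDP with
states `0, …, n-1`, actions `0, …, m-1` and parameters `0, …, k-1`, and a set of target states.
`row s a = none` means that `a` is not available in `s`. -/
structure SimpleInstance where
  n : ℕ
  m : ℕ
  k : ℕ
  init : Fin n
  target : Finset (Fin n)
  row : Fin n → Fin m → Option (Fin n → Label k)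
  exists_row : ∀ s, ∃ a f, row s a = some f
  sum_one : ∀ s a f, row s a = some f → ∑ s', (f s').toPoly = 1

namespace SimpleInstance

/-- The pMDP given by an instance. -/
def toPMDP (I : SimpleInstance) : PMDP (Fin I.n) (Fin I.m) (Fin I.k) where
  init := I.init
  Act s := {a | ∃ f, I.row s a = some f}
  act_nonempty := I.exists_row
  P s a s' := match I.row s a with
    | some f => (f s').toPoly
    | none => 0

/-- The pMDP given by an instance is simple. -/
theorem toPMDP_isSimple (I : SimpleInstance) : I.toPMDP.IsSimple := by
  refine ⟨?_, ?_⟩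
  · rintro s a ⟨f, hf⟩ s'
    simp only [toPMDP, hf]
    cases f s' with
    | const a b => exact Or.inr (Or.inr ⟨_, by positivity, rfl⟩)
    | param x => exact Or.inl ⟨x, rfl⟩
    | coparam x => exact Or.inr (Or.inl ⟨x, rfl⟩)
  · rintro s a ⟨f, hf⟩
    simp only [toPMDP, hf]
    exact I.sum_one s a f hf

end SimpleInstance

/-- The input alphabet. -/
inductive Symbol
  | zero
  | one
  | sep
  | const
  | param
  | coparam
  | enabled
  | disabled

/-- A bit as a symbol. -/
def bitSymbol (b : Bool) : Symbol := if b then .one else .zero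

/-- Unary encoding, used for sizes and indices of states and parameters. -/
def unary (n : ℕ) : List Symbol := List.replicate n .one

/-- Binary encoding, used for numerators and denominators. -/
def binary (n : ℕ) : List Symbol := (Computability.encodeNat n).map bitSymbol

/-- Encoding of a transition label. -/
def Label.encode {k : ℕ} : Label k → List Symbol
  | .const a b => .const :: (binary a ++ .sep :: (binary b ++ [.sep]))
  | .param x => .param :: (unary x ++ [.sep])
  | .coparam x => .coparam :: (unary x ++ [.sep])

/-- Encoding of the distribution over successors belonging to a state and an action. -/
def encodeRow {n k : ℕ} : Option (Fin n → Label k) → List Symbol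
  | none => [.disabled]
  | some f => .enabled :: (List.ofFn fun s' => (f s').encode).flatten

/-- Encoding of an instance: the sizes, the initial state, the characteristic vector of the target
set, and all rows in lexicographic order of states and actions. -/
def SimpleInstance.encode (I : SimpleInstance) : List Symbol :=
  unary I.n ++ .sep :: (unary I.m ++ .sep :: (unary I.k ++ .sep :: (unary I.init ++ .sep ::
    ((List.ofFn fun s => bitSymbol (decide (s ∈ I.target))) ++ .sep ::
      (List.ofFn fun s => (List.ofFn fun a => encodeRow (I.row s a)).flatten).flatten))))

open scoped Classical in
/-- The decision problem `L` on instances of type `α`, encoded by `enc`, is decidable in polynomial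
time: a Turing machine (with finitely many stacks) outputs the answer after a number of steps that
is bounded by a polynomial in the length of the encoded instance. -/
def PolyTimeDecidable {α Γ : Type} (enc : α → List Γ) (L : α → Prop) : Prop :=
  Nonempty (Turing.TM2ComputableInPolyTime enc Computability.encodeBool fun a => decide (L a))

end

end ParamMDP

/-!
# Qualitative reachability in simple parametric Markov decision processes

For qualitative questions only the supports of the transition probabilities matter, and the support
of a label `x`, `1 - x` or `q` under a well-defined valuation is determined by the *kind* of every
parameter value: whether it is `0`, `1`, or neither. Conversely, all kinds occur: replacing every
parameter value by `0`, `1` or `1 / 2` according to its kind gives values in the unit interval, and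
such valuations of a simple pMDP are well-defined. Hence there are at most `3 ^ |X|` sets of
vanishing transitions, whose fibres are the sets of the partition (`PMDP.exists_partition`).

For graph-preserving valuations, the constant valuation `1 / 2` answers the question
(`SimpleInstance.reach_gpVal_iff`). It has the largest supports among all well-defined valuations,
and positivity of a reachability probability is monotone in the supports, so it also answers the
question of positive reachability (`SimpleInstance.reach_positive_iff`). For at most `K` parameters,
the question becomes a disjunction over the `3 ^ K`, or `2 ^ K`, choices of kinds, a number that
does not depend on the input (`SimpleInstance.reach_wdVal_iff`, `SimpleInstance.reach_boolVal_iff`).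

For a fixed choice of kinds, the question for existentially quantified strategies is answered by two
nested fixed points of a monotone function on sets of states, each of which is reached after as many
iterations as there are states (`MDP.solve_iff`). The strategies are read off from the stages of the
iterations, and their analysis rests on the fact that reachability probabilities are harmonic
outside the target (`MC.reachFrom_eq_of_le`, `MC.reachFrom_eq_zero`). Universal quantification over
strategies is reduced to existential quantification by negating the condition.

For the polynomial time bound, the nested iteration is written in a small language of structured
programs on stacks, which is compiled to multi-stack Turing machines with the exact number of steps
(`StackProg.Cmd.Exec.runs`, `StackProg.polyTimeDecidable_of_cmd`). The program turns the input into
a sequence of tokens, one for every transition besides markers for states and actions, that say for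
each of the choices of kinds whether the transition has a positive probability
(`run_readInstance`). A step of the iteration is then a single pass over the tokens, in parallel
with repeated passes over the list of states (`run_stepCells`).
-/

/-! ### A structured language of stack programs -/

namespace StackProg

open Turing

/-- Structured programs over finitely many stacks, the stack `k` having alphabet `Γ k`.
`pop k e f` removes the top symbol `x` of the stack `k` and goes on with `f x`, or with `e` if the
stack is empty. `loop k isEnd f` keeps removing the top symbol `x` of the stack `k` and running
`f x`, until the stack is empty or a symbol with `isEnd x` has been removed. -/
inductive Cmd {K : Type} (Γ : K → Type) : Type
  | skip : Cmd Γ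
  | push (k : K) (x : Γ k) : Cmd Γ
  | seq (c d : Cmd Γ) : Cmd Γ
  | pop (k : K) (e : Cmd Γ) (f : Γ k → Cmd Γ) : Cmd Γ
  | loop (k : K) (isEnd : Γ k → Bool) (f : Γ k → Cmd Γ) : Cmd Γ

variable {K : Type} [DecidableEq K] {Γ : K → Type}

namespace Cmd

/-- Big-step semantics: `Exec c S S' t` means that `c` transforms the stacks `S` into `S'` in
exactly `t` steps. -/
inductive Exec : Cmd Γ → (∀ k, List (Γ k)) → (∀ k, List (Γ k)) → ℕ → Prop
  | skip (S) : Exec skip S S 1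
  | push (k x S) : Exec (push k x) S (Function.update S k (x :: S k)) 1
  | seq {c d S S' S'' t t'} : Exec c S S' t → Exec d S' S'' t' → Exec (seq c d) S S'' (t + t')
  | pop_nil {k e f S S' t} : S k = [] → Exec e S S' t → Exec (pop k e f) S S' (1 + t)
  | pop_cons {k e f S S' t} (x l) : S k = x :: l → Exec (f x) (Function.update S k l) S' t →
      Exec (pop k e f) S S' (1 + t)
  | loop_nil {k isEnd f S} : S k = [] → Exec (loop k isEnd f) S S 1
  | loop_exit {k isEnd f S} (x l) : S k = x :: l → isEnd x = true →
      Exec (loop k isEnd f) S (Function.update S k l) 1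
  | loop_cons {k isEnd f S S' S'' t t'} (x l) : S k = x :: l → isEnd x = false →
      Exec (f x) (Function.update S k l) S' t → Exec (loop k isEnd f) S' S'' t' →
      Exec (loop k isEnd f) S S'' (1 + t + t')

/-! ### Compiling stack programs to Turing machines -/

/-- The labels of the machine code of a program. -/
def Lbl : Cmd Γ → Type
  | skip => Unit
  | push _ _ => Unit
  | seq c d => c.Lbl ⊕ d.Lbl
  | pop k e f => Option (e.Lbl ⊕ Σ x : Γ k, (f x).Lbl)
  | loop k _ f => Option (Σ x : Γ k, (f x).Lbl)

omit [DecidableEq K] in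
theorem finite_lbl [∀ k, Finite (Γ k)] : ∀ c : Cmd Γ, Finite c.Lbl
  | skip => inferInstanceAs (Finite Unit)
  | push _ _ => inferInstanceAs (Finite Unit)
  | seq c d =>
    have := finite_lbl c
    have := finite_lbl d
    inferInstanceAs (Finite (c.Lbl ⊕ d.Lbl))
  | pop k e f =>
    have := finite_lbl e
    have := fun x => finite_lbl (f x)
    inferInstanceAs (Finite (Option (e.Lbl ⊕ Σ x : Γ k, (f x).Lbl)))
  | loop k _ f =>
    have := fun x => finite_lbl (f x)
    inferInstanceAs (Finite (Option (Σ x : Γ k, (f x).Lbl)))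

/-- The label at which the code of a program is entered. -/
def entry : (c : Cmd Γ) → c.Lbl
  | skip => ()
  | push _ _ => ()
  | seq c _ => .inl c.entry
  | pop _ _ _ => none
  | loop _ _ _ => none

end Cmd

/-- The internal memory of the compiled machines: the symbols most recently removed. -/
abbrev Mem (Γ : K → Type) : Type := ∀ k, Option (Γ k)

/-- Embed code into a larger machine, continuing at `e` where it used to halt. -/
def relabel {σ Λ Λ' : Type} (f : Λ → Λ') (e : Option Λ') :
    TM2.Stmt Γ Λ σ → TM2.Stmt Γ Λ' σ
  | .push k g q => .push k g (relabel f e q)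
  | .peek k g q => .peek k g (relabel f e q)
  | .pop k g q => .pop k g (relabel f e q)
  | .load g q => .load g (relabel f e q)
  | .branch p q q' => .branch p (relabel f e q) (relabel f e q')
  | .goto g => .goto fun v => f (g v)
  | .halt => match e with
    | some l => .goto fun _ => l
    | none => .halt

theorem stepAux_relabel {σ Λ Λ' : Type} (f : Λ → Λ') (e : Option Λ') (q : TM2.Stmt Γ Λ σ)
    (v : σ) (S : ∀ k, List (Γ k)) :
    TM2.stepAux (relabel f e q) v S =
      ⟨((TM2.stepAux q v S).l.map f).or e, (TM2.stepAux q v S).var, (TM2.stepAux q v S).stk⟩ := by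
  induction q generalizing v S with
  | branch p q q' ih ih' => cases h : p v <;> simp [relabel, h, ih, ih']
  | halt => cases e <;> simp [relabel]
  | _ => simp_all [relabel]

/-- `Runs m t c c'`: the machine `m` takes the configuration `c` to `c'` in exactly `t` steps. -/
def Runs {σ Λ : Type} (m : Λ → TM2.Stmt Γ Λ σ) (t : ℕ) (c c' : TM2.Cfg Γ Λ σ) : Prop :=
  (flip bind (TM2.step m))^[t] (some c) = some c'

theorem Runs.trans {σ Λ : Type} {m : Λ → TM2.Stmt Γ Λ σ} {t t' : ℕ} {c c' c'' : TM2.Cfg Γ Λ σ}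
    (h : Runs m t c c') (h' : Runs m t' c' c'') : Runs m (t + t') c c'' := by
  unfold Runs at *
  rw [add_comm, Function.iterate_add_apply, h, h']

theorem Runs.one {σ Λ : Type} {m : Λ → TM2.Stmt Γ Λ σ} {l : Λ} {v : σ} {S : ∀ k, List (Γ k)}
    {c : TM2.Cfg Γ Λ σ} (h : TM2.stepAux (m l) v S = c) : Runs m 1 ⟨some l, v, S⟩ c := by
  simp [Runs, flip, TM2.step, h]

theorem iterate_bind_none {α : Type*} (f : α → Option α) (t : ℕ) :
    (flip bind f)^[t] none = none := by
  induction t with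
  | zero => rfl
  | succ t ih => rw [Function.iterate_succ_apply]; exact ih

/-- A complete run of a piece of code is a run of every machine in which it is embedded. -/
theorem Runs.relabel {σ Λ Λ' : Type} {m : Λ → TM2.Stmt Γ Λ σ} {m' : Λ' → TM2.Stmt Γ Λ' σ}
    {f : Λ → Λ'} {e : Option Λ'} (hm : ∀ l, m' (f l) = relabel f e (m l)) {t : ℕ} {l : Λ}
    {v v' : σ} {S S' : ∀ k, List (Γ k)} (h : Runs m t ⟨some l, v, S⟩ ⟨none, v', S'⟩) :
    Runs m' t ⟨some (f l), v, S⟩ ⟨e, v', S'⟩ := by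
  induction t generalizing l v S with
  | zero => simp [Runs] at h
  | succ t ih =>
    unfold Runs at *
    rw [Function.iterate_succ_apply] at h ⊢
    simp only [flip, bind, Option.bind, TM2.step] at h ⊢
    rw [hm, stepAux_relabel]
    rcases hc : TM2.stepAux (m l) v S with ⟨_ | l₁, v₁, S₁⟩
    · rw [hc] at h
      cases t with
      | zero => simp at h; simp [h]
      | succ t =>
        rw [Function.iterate_succ_apply] at h
        exact absurd (h.symm.trans (iterate_bind_none _ t)) (by simp)
    · rw [hc] at h
      exact ih h

namespace Cmd

/-- The machine code of a program. -/
def code : (c : Cmd Γ) → c.Lbl → TM2.Stmt Γ c.Lbl (Mem Γ)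
  | skip => fun _ => .halt
  | push k x => fun _ => .push k (fun _ => x) .halt
  | seq c d => fun l => match l with
    | .inl l => relabel (Λ' := c.Lbl ⊕ d.Lbl) .inl (some (.inr d.entry)) (c.code l)
    | .inr l => relabel (Λ' := c.Lbl ⊕ d.Lbl) .inr none (d.code l)
  | pop k e f => fun l => match l with
    | none => .pop k (fun v o => Function.update v k o) <| .goto fun v =>
        match v k with
        | none => some (.inl e.entry)
        | some x => some (.inr ⟨x, (f x).entry⟩)
    | some (.inl l) =>
      relabel (Λ' := Option (e.Lbl ⊕ Σ x : Γ k, (f x).Lbl)) (fun l => some (.inl l)) none (e.code l)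
    | some (.inr ⟨x, l⟩) =>
      relabel (Λ' := Option (e.Lbl ⊕ Σ x : Γ k, (f x).Lbl)) (fun l => some (.inr ⟨x, l⟩)) none
        ((f x).code l)
  | loop k isEnd f => fun l => match l with
    | none => .pop k (fun v o => Function.update v k o) <|
        .branch (fun v => (v k).all isEnd) .halt <| .goto fun v =>
          match v k with
          | none => none
          | some x => some ⟨x, (f x).entry⟩
    | some ⟨x, l⟩ =>
      relabel (Λ' := Option (Σ x : Γ k, (f x).Lbl)) (fun l => some ⟨x, l⟩) (some none)
        ((f x).code l)

/-- The machine code of a program implements its big-step semantics. -/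
theorem Exec.runs {c : Cmd Γ} {S S' : ∀ k, List (Γ k)} {t : ℕ} (h : Exec c S S' t) (v : Mem Γ) :
    ∃ v', Runs c.code t ⟨some c.entry, v, S⟩ ⟨none, v', S'⟩ := by
  induction h generalizing v with
  | skip S => exact ⟨v, Runs.one rfl⟩
  | push k x S => exact ⟨v, Runs.one rfl⟩
  | @seq c d S S' S'' t t' _ _ ih ih' =>
    obtain ⟨v₁, h₁⟩ := ih v
    obtain ⟨v₂, h₂⟩ := ih' v₁
    exact ⟨v₂, (Runs.relabel (m' := (Cmd.seq c d).code) (f := Sum.inl)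
      (fun _ => by simp only [code]; rfl) h₁).trans (Runs.relabel (m' := (Cmd.seq c d).code)
      (f := Sum.inr) (fun _ => by simp only [code]; rfl) h₂)⟩
  | @pop_nil k e f S S' t hS _ ih =>
    obtain ⟨v₁, h₁⟩ := ih (Function.update v k none)
    refine ⟨v₁, Runs.trans (Runs.one ?_) (Runs.relabel (m' := (pop k e f).code)
      (f := fun l => some (.inl l)) (e := none) (fun _ => by simp only [code]; rfl) h₁)⟩
    simp [entry, code, TM2.stepAux, hS]
  | @pop_cons k e f S S' t x l hS _ ih =>
    obtain ⟨v₁, h₁⟩ := ih (Function.update v k (some x))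
    refine ⟨v₁, Runs.trans (Runs.one ?_) (Runs.relabel (m' := (pop k e f).code)
      (f := fun l => some (.inr ⟨x, l⟩)) (e := none) (fun _ => by simp only [code]; rfl) h₁)⟩
    simp [entry, code, TM2.stepAux, hS]
  | @loop_nil k isEnd f S hS =>
    refine ⟨Function.update v k none, Runs.one ?_⟩
    simp [entry, code, TM2.stepAux, hS]
  | @loop_exit k isEnd f S x l hS hx =>
    refine ⟨Function.update v k (some x), Runs.one ?_⟩
    simp [entry, code, TM2.stepAux, hS, hx]
  | @loop_cons k isEnd f S S' S'' t t' x l hS hx _ _ ih ih' =>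
    obtain ⟨v₁, h₁⟩ := ih (Function.update v k (some x))
    obtain ⟨v₂, h₂⟩ := ih' v₁
    refine ⟨v₂, (Runs.trans (Runs.one ?_) (Runs.relabel (m' := (loop k isEnd f).code)
      (f := fun l => some ⟨x, l⟩) (e := some none) (fun _ => by simp only [code]; rfl)
      h₁)).trans h₂⟩
    simp [entry, code, TM2.stepAux, hS, hx]

/-- `Does c S S' t` means that `c` transforms the stacks `S` into `S'` in at most `t` steps. -/
def Does (c : Cmd Γ) (S S' : ∀ k, List (Γ k)) (t : ℕ) : Prop := ∃ t' ≤ t, Exec c S S' t'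

theorem Does.mono {c : Cmd Γ} {S S' : ∀ k, List (Γ k)} {t t' : ℕ} (h : Does c S S' t)
    (ht : t ≤ t') : Does c S S' t' :=
  let ⟨u, hu, hc⟩ := h; ⟨u, hu.trans ht, hc⟩

theorem does_skip (S : ∀ k, List (Γ k)) : Does skip S S 1 := ⟨1, le_rfl, .skip S⟩

theorem does_push (k : K) (x : Γ k) (S : ∀ k, List (Γ k)) :
    Does (push k x) S (Function.update S k (x :: S k)) 1 := ⟨1, le_rfl, .push k x S⟩

theorem Does.seq {c d : Cmd Γ} {S S' S'' : ∀ k, List (Γ k)} {t t' : ℕ} (h : Does c S S' t)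
    (h' : Does d S' S'' t') : Does (seq c d) S S'' (t + t') :=
  let ⟨_, hu, hc⟩ := h; let ⟨_, hu', hd⟩ := h'; ⟨_, add_le_add hu hu', hc.seq hd⟩

theorem Does.pop_nil {k : K} {e : Cmd Γ} {f : Γ k → Cmd Γ} {S S' : ∀ k, List (Γ k)} {t : ℕ}
    (hS : S k = []) (h : Does e S S' t) : Does (pop k e f) S S' (1 + t) :=
  let ⟨_, hu, hc⟩ := h; ⟨_, by lia, .pop_nil hS hc⟩

theorem Does.pop_cons {k : K} {e : Cmd Γ} {f : Γ k → Cmd Γ} {S S' : ∀ k, List (Γ k)} {t : ℕ}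
    {x : Γ k} {l : List (Γ k)} (hS : S k = x :: l) (h : Does (f x) (Function.update S k l) S' t) :
    Does (pop k e f) S S' (1 + t) :=
  let ⟨_, hu, hc⟩ := h; ⟨_, by lia, .pop_cons x l hS hc⟩

theorem does_loop_nil {k : K} {isEnd : Γ k → Bool} {f : Γ k → Cmd Γ} {S : ∀ k, List (Γ k)}
    (hS : S k = []) : Does (loop k isEnd f) S S 1 := ⟨1, le_rfl, .loop_nil hS⟩

theorem does_loop_exit {k : K} {isEnd : Γ k → Bool} {f : Γ k → Cmd Γ} {S : ∀ k, List (Γ k)}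
    {x : Γ k} {l : List (Γ k)} (hS : S k = x :: l) (hx : isEnd x = true) :
    Does (loop k isEnd f) S (Function.update S k l) 1 := ⟨1, le_rfl, .loop_exit x l hS hx⟩

theorem Does.loop_cons {k : K} {isEnd : Γ k → Bool} {f : Γ k → Cmd Γ} {S S' S'' : ∀ k, List (Γ k)}
    {t t' : ℕ} {x : Γ k} {l : List (Γ k)} (hS : S k = x :: l) (hx : isEnd x = false)
    (h : Does (f x) (Function.update S k l) S' t) (h' : Does (loop k isEnd f) S' S'' t') :
    Does (loop k isEnd f) S S'' (1 + t + t') :=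
  let ⟨_, hu, hc⟩ := h; let ⟨_, hu', hd⟩ := h'; ⟨_, by lia, .loop_cons x l hS hx hc hd⟩

/-- Remove all symbols from the stacks in a list. -/
def clear : List K → Cmd Γ
  | [] => skip
  | k :: ks => seq (loop k (fun _ => false) fun _ => skip) (clear ks)

end Cmd

/-! ### Deciding problems with stack programs -/

open Cmd in
/-- A problem is decidable in polynomial time if a stack program answers it in polynomial time on
its output stack, and leaves the other stacks empty. -/
theorem polyTimeDecidable_of_cmd {α Γ₀ : Type} [Fintype K] [∀ k, Finite (Γ k)] (enc : α → List Γ₀)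
    (L : α → Prop) (k₀ k₁ : K) (e₀ : Γ k₀ ≃ Γ₀) (e₁ : Γ k₁ ≃ Bool) (c : Cmd Γ)
    (p : Polynomial ℕ)
    (h : ∀ a, ∃ b : Bool, (b = true ↔ L a) ∧
      Does c (Function.update (fun _ => []) k₀ ((enc a).map e₀.symm))
        (Function.update (fun _ => []) k₁ [e₁.symm b]) (p.eval (enc a).length)) :
    ParamMDP.PolyTimeDecidable enc L := by
  classical
  have := c.finite_lbl
  have : ∀ k, Fintype (Γ k) := fun k => Fintype.ofFinite _
  have : Fintype c.Lbl := Fintype.ofFinite _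
  -- after the program, the machine resets its internal memory and halts
  let m : Option c.Lbl → TM2.Stmt Γ (Option c.Lbl) (Mem Γ) := fun l => match l with
    | none => .load (fun _ _ => none) .halt
    | some l => relabel some (some none) (c.code l)
  let tm : FinTM2 :=
    { K := K
      k₀ := k₀
      k₁ := k₁
      Γ := Γ
      Λ := Option c.Lbl
      main := some c.entry
      σ := Mem Γ
      initialState := fun _ => none
      m := m }
  refine ⟨{
    tm := tm
    inputAlphabet := e₀
    outputAlphabet := e₁
    time := p + 1
    outputsFun := fun a => Classical.choice ?_ }⟩
  obtain ⟨b, hb, t, ht, hc⟩ := h a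
  obtain ⟨v, hv⟩ := hc.runs fun _ => none
  have h₁ := Runs.relabel (m' := m) (f := some) (e := some none) (fun _ => rfl) hv
  have h₂ := h₁.trans (Runs.one (c := ⟨none, fun _ => none, _⟩) rfl)
  refine ⟨⟨⟨t + 1, ?_⟩, by simpa using ht⟩⟩
  have hbd : decide (L a) = b := by cases b <;> simp_all
  have hinit : initList tm ((enc a).map e₀.symm) = (⟨some (some c.entry), fun _ => none,
      Function.update (fun _ => []) k₀ ((enc a).map e₀.symm)⟩ : TM2.Cfg Γ _ _) := by
    refine congrArg (TM2.Cfg.mk _ _) (funext fun k => ?_)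
    by_cases hk : k₀ = k
    · subst hk; simp [tm]
    · simp [tm, Ne.symm hk]
  have hhalt : haltList tm [e₁.symm b] = (⟨none, fun _ => none,
      Function.update (fun _ => []) k₁ [e₁.symm b]⟩ : TM2.Cfg Γ _ _) := by
    refine congrArg (TM2.Cfg.mk _ _) (funext fun k => ?_)
    by_cases hk : k₁ = k
    · subst hk; simp [tm]
    · simp [tm, Ne.symm hk]
  rw [hbd]
  exact (congrArg (fun c => (flip bind (TM2.step m))^[t + 1] (some c)) hinit).trans
    (Eq.trans h₂ (congrArg some hhalt.symm))

end StackProg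

/-! ### Reachability probabilities in finite Markov chains -/

namespace ParamMDP

open scoped ENNReal

namespace MC

variable {S : Type*} [Fintype S] (D : MC S) (T : Set S)

/-- The probability of eventually reaching `T` from the state `s`. -/
noncomputable def reachFrom (s : S) : ℝ≥0∞ := ({ D with init := s } : MC S).reachProb T

open scoped Classical in
/-- The probability that the first visit of `T` takes place after exactly `n` steps. -/
noncomputable def hit : ℕ → S → ℝ≥0∞
  | 0, s => if s ∈ T then 1 else 0
  | n + 1, s => if s ∈ T then 0 else ∑ s', ENNReal.ofReal (D.P s s') * hit n s'

open scoped Classical in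
theorem sum_paths_eq_hit (n : ℕ) (s : S) :
    ∑ w : Fin (n + 1) → S, (if w 0 = s ∧ w (Fin.last n) ∈ T ∧ ∀ i : Fin n, w i.castSucc ∉ T then
      ∏ i : Fin n, ENNReal.ofReal (D.P (w i.castSucc) (w i.succ)) else 0) = D.hit T n s := by
  induction n generalizing s with
  | zero =>
    rw [Fintype.sum_equiv (Equiv.funUnique (Fin 1) S) _
      (fun s' => if s' = s ∧ s' ∈ T then 1 else 0) (fun w => by simp [Equiv.funUnique])]
    simp [hit, ite_and]
  | succ n ih =>
    rw [← (Fin.consEquiv fun _ : Fin (n + 2) => S).sum_comp, Fintype.sum_prod_type,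
      Fintype.sum_eq_single s (fun s₁ hs₁ => Finset.sum_eq_zero fun w _ => if_neg fun h => ?_), hit]
    swap
    · exact hs₁ (by simpa [Fin.consEquiv] using h.1)
    by_cases hs : s ∈ T
    · rw [if_pos hs]
      refine Finset.sum_eq_zero fun w _ => if_neg fun h => h.2.2 0 ?_
      simpa [Fin.consEquiv] using hs
    rw [if_neg hs]
    simp_rw [← ih, Finset.mul_sum]
    rw [Finset.sum_comm]
    refine Finset.sum_congr rfl fun w _ => ?_
    rw [Fintype.sum_eq_single (w 0) (fun s₁ hs₁ => by rw [if_neg fun h => hs₁ h.1.symm, mul_zero])]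
    simp only [Fin.consEquiv, Equiv.coe_fn_mk, Fin.cons_zero, true_and, Fin.forall_fin_succ,
      Fin.castSucc_zero, hs, not_false_eq_true, Fin.prod_univ_succ, ← Fin.succ_last, Fin.cons_succ,
      ← Fin.succ_castSucc, mul_ite, mul_zero]

theorem reachFrom_eq_tsum (s : S) : D.reachFrom T s = ∑' n, D.hit T n s := by
  classical
  unfold reachFrom reachProb
  rw [tsum_subtype, ENNReal.tsum_sigma']
  refine tsum_congr fun n => ?_
  rw [tsum_fintype, ← sum_paths_eq_hit]
  refine Finset.sum_congr rfl fun w _ => ?_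
  simp only [Set.indicator_apply, pathsTo, Set.mem_ofPred_eq, pathMass]
  by_cases h : w 0 = s ∧ w (Fin.last n) ∈ T ∧ ∀ i : Fin n, w i.castSucc ∉ T
  · rw [if_pos h]
    by_cases h' : ∀ i : Fin n, D.P (w i.castSucc) (w i.succ) ≠ 0
    · rw [if_pos ⟨h.1, h', h.2⟩]
    · rw [if_neg fun h'' => h' h''.2.1]
      push Not at h'
      obtain ⟨i, hi⟩ := h'
      exact (Finset.prod_eq_zero (Finset.mem_univ i) (by rw [hi, ENNReal.ofReal_zero])).symm
  · rw [if_neg h, if_neg fun h' => h ⟨h'.1, h'.2.2⟩]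

theorem reachFrom_of_mem {s : S} (hs : s ∈ T) : D.reachFrom T s = 1 := by
  rw [reachFrom_eq_tsum, tsum_eq_single 0 fun n hn => ?_]
  · simp [hit, hs]
  · obtain ⟨n, rfl⟩ := Nat.exists_eq_succ_of_ne_zero hn
    simp [hit, hs]

theorem reachFrom_of_notMem {s : S} (hs : s ∉ T) :
    D.reachFrom T s = ∑ s', ENNReal.ofReal (D.P s s') * D.reachFrom T s' := by
  rw [reachFrom_eq_tsum, tsum_eq_zero_add' ENNReal.summable]
  simp_rw [reachFrom_eq_tsum, ← ENNReal.tsum_mul_left]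
  rw [← Summable.tsum_finsetSum fun _ _ => ENNReal.summable]
  simp [hit, hs]

theorem sum_ofReal_eq_one (s : S) : ∑ s', ENNReal.ofReal (D.P s s') = 1 := by
  rw [← ENNReal.ofReal_sum_of_nonneg fun s' _ => D.nonneg s s', D.sum_one, ENNReal.ofReal_one]

theorem reachFrom_le_one (s : S) : D.reachFrom T s ≤ 1 := by
  classical
  rw [reachFrom_eq_tsum]
  refine ENNReal.tsum_le_of_sum_range_le fun n => ?_
  induction n generalizing s with
  | zero => simp
  | succ n ih =>
    rw [Finset.sum_range_succ']
    by_cases hs : s ∈ T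
    · simp [hit, hs]
    · simp only [hit, hs, if_false, add_zero]
      rw [Finset.sum_comm]
      simp_rw [← Finset.mul_sum]
      refine (Finset.sum_le_sum fun s' _ => mul_le_mul_right (ih s') _).trans ?_
      simp [D.sum_ofReal_eq_one]

variable {T} in
/-- A closed set of non-target states never reaches the target. -/
theorem reachFrom_eq_zero {C : Set S} (hC : ∀ s ∈ C, s ∉ T ∧ ∀ s', D.P s s' ≠ 0 → s' ∈ C) {s : S}
    (hs : s ∈ C) : D.reachFrom T s = 0 := by
  rw [reachFrom_eq_tsum, ENNReal.tsum_eq_zero]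
  intro n
  induction n generalizing s with
  | zero => simp [hit, (hC s hs).1]
  | succ n ih =>
    simp only [hit, (hC s hs).1, if_false]
    refine Finset.sum_eq_zero fun s' _ => ?_
    by_cases h : D.P s s' = 0
    · simp [h]
    · rw [ih ((hC s hs).2 s' h), mul_zero]

theorem toReal_reachFrom {s : S} (hs : s ∉ T) :
    (D.reachFrom T s).toReal = ∑ s', D.P s s' * (D.reachFrom T s').toReal := by
  rw [D.reachFrom_of_notMem T hs, ENNReal.toReal_sum fun s' _ =>
    ENNReal.mul_ne_top ENNReal.ofReal_ne_top ((D.reachFrom_le_one T s').trans_lt (by simp)).ne]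
  exact Finset.sum_congr rfl fun s' _ => by
    rw [ENNReal.toReal_mul, ENNReal.toReal_ofReal (D.nonneg s s')]

theorem reachFrom_ne_top (s : S) : D.reachFrom T s ≠ ∞ :=
  ((D.reachFrom_le_one T s).trans_lt (by simp)).ne

variable {T} in
/-- Minimum principle: reachability probabilities are harmonic outside the target. -/
theorem reachFrom_eq_of_le {s s' : S} (hs : s ∉ T) {m : ℝ≥0∞} (hm : D.reachFrom T s ≤ m)
    (hle : ∀ s', D.P s s' ≠ 0 → m ≤ D.reachFrom T s') (h : D.P s s' ≠ 0) :
    D.reachFrom T s' = m := by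
  have hmt : m ≠ ∞ := ne_top_of_le_ne_top (D.reachFrom_ne_top T s') (hle s' h)
  have h₀ : ∀ s', 0 ≤ D.P s s' * ((D.reachFrom T s').toReal - m.toReal) := by
    intro s'
    by_cases h : D.P s s' = 0
    · simp [h]
    · exact mul_nonneg (D.nonneg s s') (sub_nonneg.2
        (ENNReal.toReal_mono (D.reachFrom_ne_top T s') (hle s' h)))
  have h₁ : ∑ s', D.P s s' * ((D.reachFrom T s').toReal - m.toReal) = 0 := by
    refine le_antisymm ?_ (Finset.sum_nonneg fun s' _ => h₀ s')
    simp_rw [mul_sub, Finset.sum_sub_distrib, ← Finset.sum_mul, D.sum_one, one_mul,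
      ← D.toReal_reachFrom T hs]
    exact sub_nonpos.2 (ENNReal.toReal_mono hmt hm)
  have h₂ := (Finset.sum_eq_zero_iff_of_nonneg fun s' _ => h₀ s').1 h₁ s' (Finset.mem_univ _)
  rw [mul_eq_zero, or_iff_right h, sub_eq_zero] at h₂
  exact (ENNReal.toReal_eq_toReal_iff' (D.reachFrom_ne_top T s') hmt).1 h₂

variable {T} in
theorem reachFrom_succ_eq_zero {s s' : S} (hs : s ∉ T) (h0 : D.reachFrom T s = 0)
    (h : D.P s s' ≠ 0) : D.reachFrom T s' = 0 :=
  D.reachFrom_eq_of_le hs h0.le (fun _ _ => zero_le) h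

variable {T} in
theorem reachFrom_succ_eq_one {s s' : S} (hs : s ∉ T) (h1 : D.reachFrom T s = 1)
    (h : D.P s s' ≠ 0) : D.reachFrom T s' = 1 := by
  have h₀ : ∀ s', 0 ≤ D.P s s' * (1 - (D.reachFrom T s').toReal) := fun s' =>
    mul_nonneg (D.nonneg s s') (sub_nonneg.2
      (by simpa using ENNReal.toReal_mono ENNReal.one_ne_top (D.reachFrom_le_one T s')))
  have h₁ : ∑ s', D.P s s' * (1 - (D.reachFrom T s').toReal) = 0 := by
    simp_rw [mul_sub, Finset.sum_sub_distrib, mul_one, D.sum_one, ← D.toReal_reachFrom T hs, h1]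
    simp
  have h₂ := (Finset.sum_eq_zero_iff_of_nonneg fun s' _ => h₀ s').1 h₁ s' (Finset.mem_univ _)
  rw [mul_eq_zero, or_iff_right h, sub_eq_zero] at h₂
  exact (ENNReal.toReal_eq_one_iff _).1 h₂.symm

end MC

/-! ### Iterating monotone functions on finite orders -/

/-- Iterating a monotone function from the bottom of an order of height at most `n` reaches a fixed
point after `n` steps. -/
theorem iterate_bot_fixed {α : Type*} [PartialOrder α] [OrderBot α] {f : α → α} (hf : Monotone f)
    {r : α → ℕ} (hr : StrictMono r) {n : ℕ} (hn : ∀ a, r a ≤ n) : f (f^[n] ⊥) = f^[n] ⊥ := by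
  by_contra hne
  have hk : ∀ k ≤ n, f^[k] ⊥ < f^[k + 1] ⊥ := by
    intro k hk
    refine lt_of_le_of_ne ?_ fun h => hne ?_
    · rw [Function.iterate_succ_apply]
      exact hf.iterate k bot_le
    · rw [Function.iterate_succ_apply'] at h
      obtain ⟨j, rfl⟩ := Nat.exists_eq_add_of_le' hk
      rw [Function.iterate_add_apply, Function.iterate_fixed h.symm, ← h]
  have hr' : ∀ k ≤ n + 1, k ≤ r (f^[k] ⊥) := by
    intro k
    induction k with
    | zero => simp
    | succ k ih => exact fun h => (ih (by lia)).trans_lt (hr (hk k (by lia)))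
  have := hr' (n + 1) le_rfl
  have := hn (f^[n + 1] ⊥)
  lia

theorem iterate_bot_le {α : Type*} [PartialOrder α] [OrderBot α] {f : α → α} (hf : Monotone f)
    {y : α} (hy : f y ≤ y) (n : ℕ) : f^[n] ⊥ ≤ y := by
  induction n with
  | zero => exact bot_le
  | succ n ih => rw [Function.iterate_succ_apply']; exact (hf ih).trans hy

theorem iterate_bot_mono {α : Type*} [PartialOrder α] [OrderBot α] {f : α → α} (hf : Monotone f) :
    Monotone fun k => f^[k] ⊥ :=
  monotone_nat_of_le_succ fun k => by
    rw [Function.iterate_succ_apply]; exact hf.iterate k bot_le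

theorem le_iff_bool {S : Type*} {x y : S → Bool} : x ≤ y ↔ ∀ s, x s = true → y s = true :=
  forall_congr' fun _ => Bool.le_iff_imp

section BoolFunctions

variable {S : Type*} [Fintype S] {f : (S → Bool) → S → Bool} (hf : Monotone f) {n : ℕ}
  (hn : Fintype.card S ≤ n)

include hf hn

theorem iterate_bot_fixed_bool : f (f^[n] ⊥) = f^[n] ⊥ := by
  classical
  refine iterate_bot_fixed (r := fun x => (Finset.univ.filter fun s => x s = true).card) hf
    (fun x y hxy => Finset.card_lt_card ?_) (fun x => (Finset.card_le_univ _).trans hn)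
  rw [Finset.ssubset_iff_of_subset fun s => by simpa using le_iff_bool.1 hxy.le s]
  obtain ⟨s, hs⟩ := (Pi.lt_def.1 hxy).2
  exact ⟨s, by simp [Bool.eq_true_of_true_le, Bool.lt_iff.1 hs]⟩

theorem iterate_top_fixed_bool : f (f^[n] ⊤) = f^[n] ⊤ := by
  classical
  refine iterate_bot_fixed (α := (S → Bool)ᵒᵈ)
    (r := fun x => (Finset.univ.filter fun s => OrderDual.ofDual x s = false).card) hf.dual
    (fun x y hxy => Finset.card_lt_card ?_) (fun x => (Finset.card_le_univ _).trans hn)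
  have hxy' : OrderDual.ofDual y < OrderDual.ofDual x := hxy
  rw [Finset.ssubset_iff_of_subset fun s => by
    have := le_iff_bool.1 hxy'.le s
    simp only [Finset.mem_filter, Finset.mem_univ, true_and]
    intro h
    by_contra h'
    simp_all]
  obtain ⟨s, hs⟩ := (Pi.lt_def.1 hxy').2
  exact ⟨s, by simp [Bool.lt_iff.1 hs]⟩

end BoolFunctions

theorem le_iterate_top {α : Type*} [PartialOrder α] [OrderTop α] {f : α → α} (hf : Monotone f)
    {y : α} (hy : y ≤ f y) (n : ℕ) : y ≤ f^[n] ⊤ :=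
  iterate_bot_le (α := αᵒᵈ) hf.dual hy n

end ParamMDP

/-! ### Solving qualitative reachability by nested fixed points -/

namespace ParamMDP

open scoped ENNReal

namespace Qualitative

/-- Whether the outer one of the two nested fixed points is a greatest fixed point. The inner one
is then a least fixed point, and conversely. -/
def outerGreatest : Qualitative → Bool
  | positive | almostSure => true
  | safety | unsure => false

/-- How membership in the target and the existence of a suitable action combine. -/
def combine : Qualitative → Bool → Bool → Bool
  | positive, t, e | almostSure, t, e => t || e
  | safety, t, e | unsure, t, e => !t && e

/-- Whether an action is suitable, given whether all its successors lie in the greatest fixed point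
and whether some successor lies in the least fixed point. -/
def suitable : Qualitative → Bool → Bool → Bool
  | positive, _, e => e
  | almostSure, a, e => a && e
  | safety, a, _ => a
  | unsure, a, e => a || e

variable {S A : Type*} (φ : Qualitative) (act : S → A → Prop) (edge : S → A → S → Prop)
  (t : S → Bool)

open scoped Classical in
/-- One step of the fixed-point iteration, for the sets `ν` and `μ` that approximate the greatest
and the least fixed point. -/
noncomputable def pre (ν μ : S → Bool) (s : S) : Bool :=
  φ.combine (t s) (decide (∃ a, act s a ∧ φ.suitable (decide (∀ s', edge s a s' → ν s' = true))
    (decide (∃ s', edge s a s' ∧ μ s' = true)) = true))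

/-- One step of the fixed-point iteration, for the sets that approximate the outer and the inner
fixed point. -/
noncomputable def body (out inn : S → Bool) : S → Bool :=
  if φ.outerGreatest then φ.pre act edge t out inn else φ.pre act edge t inn out

/-- The inner fixed-point iteration. -/
noncomputable def inner (n : ℕ) (out : S → Bool) : S → Bool :=
  (φ.body act edge t out)^[n] fun _ => !φ.outerGreatest

/-- The nested fixed-point iteration. -/
noncomputable def solve (n : ℕ) : S → Bool :=
  (φ.inner act edge t n)^[n] fun _ => φ.outerGreatest

variable {φ act edge t}

theorem combine_mono {t e e' : Bool} (h : e = true → e' = true) (he : φ.combine t e = true) :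
    φ.combine t e' = true := by
  cases φ <;> cases t <;> simp_all [combine]

theorem suitable_mono {a a' e e' : Bool} (ha : a = true → a' = true) (he : e = true → e' = true)
    (h : φ.suitable a e = true) : φ.suitable a' e' = true := by
  cases φ <;> simp_all [suitable]
  exact h.imp ha he

theorem pre_mono {ν ν' μ μ' : S → Bool} (hν : ν ≤ ν') (hμ : μ ≤ μ') :
    φ.pre act edge t ν μ ≤ φ.pre act edge t ν' μ' := by
  rw [le_iff_bool] at *
  intro s hs
  classical
  unfold pre at hs ⊢
  refine combine_mono (fun h => ?_) hs
  rw [decide_eq_true_eq] at *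
  obtain ⟨a, ha, h⟩ := h
  refine ⟨a, ha, suitable_mono ?_ ?_ h⟩ <;> simp only [decide_eq_true_eq]
  · exact fun h s' hs' => hν _ (h s' hs')
  · exact fun ⟨s', hs', h⟩ => ⟨s', hs', hμ _ h⟩

theorem combine_eq_pre {ν μ : S → Bool} {s : S} {b : Bool}
    (h : b = true ↔ ∃ a, act s a ∧ ∃ p q : Bool, (p = true ↔ ∀ s', edge s a s' → ν s' = true) ∧
      (q = true ↔ ∃ s', edge s a s' ∧ μ s' = true) ∧ φ.suitable p q = true) :
    φ.combine (t s) b = φ.pre act edge t ν μ s := by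
  classical
  unfold pre
  congr 1
  refine Bool.eq_iff_iff.2 (h.trans ?_)
  rw [decide_eq_true_eq]
  refine exists_congr fun a => and_congr_right fun _ => ⟨?_, fun h =>
    ⟨_, _, decide_eq_true_iff, decide_eq_true_iff, h⟩⟩
  rintro ⟨p, q, hp, hq, h⟩
  simpa only [← hp, ← hq, Bool.decide_eq_true] using h

theorem body_mono {o o' i i' : S → Bool} (ho : o ≤ o') (hi : i ≤ i') :
    φ.body act edge t o i ≤ φ.body act edge t o' i' := by
  unfold body
  split
  · exact pre_mono ho hi
  · exact pre_mono hi ho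

theorem inner_mono (n : ℕ) : Monotone (φ.inner act edge t n) := fun _ _ h =>
  Monotone.iterate_le_of_le (fun _ _ hi => body_mono le_rfl hi) (fun _ => body_mono h le_rfl) n _

theorem pre_positive_iff {ν μ : S → Bool} {s : S} : positive.pre act edge t ν μ s = true ↔
    t s = true ∨ ∃ a, act s a ∧ ∃ s', edge s a s' ∧ μ s' = true := by
  classical
  simp only [pre, combine, suitable, Bool.or_eq_true, decide_eq_true_eq]

theorem pre_almostSure_iff {ν μ : S → Bool} {s : S} : almostSure.pre act edge t ν μ s = true ↔
    t s = true ∨ ∃ a, act s a ∧ (∀ s', edge s a s' → ν s' = true) ∧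
      ∃ s', edge s a s' ∧ μ s' = true := by
  classical
  simp only [pre, combine, suitable, Bool.or_eq_true, Bool.and_eq_true, decide_eq_true_eq]

theorem pre_safety_iff {ν μ : S → Bool} {s : S} : safety.pre act edge t ν μ s = true ↔
    ¬ t s = true ∧ ∃ a, act s a ∧ ∀ s', edge s a s' → ν s' = true := by
  classical
  simp only [pre, combine, suitable, Bool.and_eq_true, decide_eq_true_eq, Bool.not_eq_true',
    Bool.not_eq_true]

theorem pre_unsure_iff {ν μ : S → Bool} {s : S} : unsure.pre act edge t ν μ s = true ↔
    ¬ t s = true ∧ ∃ a, act s a ∧ ((∀ s', edge s a s' → ν s' = true) ∨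
      ∃ s', edge s a s' ∧ μ s' = true) := by
  classical
  simp only [pre, combine, suitable, Bool.and_eq_true, Bool.or_eq_true, decide_eq_true_eq,
    Bool.not_eq_true', Bool.not_eq_true]

variable [Fintype S] {n : ℕ} (hn : Fintype.card S ≤ n)

include hn

theorem inner_fixed (o : S → Bool) :
    φ.body act edge t o (φ.inner act edge t n o) = φ.inner act edge t n o := by
  have hm : Monotone (φ.body act edge t o) := fun _ _ hi => body_mono le_rfl hi
  unfold inner
  cases φ.outerGreatest
  · exact iterate_top_fixed_bool hm hn
  · exact iterate_bot_fixed_bool hm hn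

theorem solve_fixed : φ.inner act edge t n (φ.solve act edge t n) = φ.solve act edge t n := by
  unfold solve
  cases φ.outerGreatest
  · exact iterate_bot_fixed_bool (inner_mono n) hn
  · exact iterate_top_fixed_bool (inner_mono n) hn

theorem body_solve : φ.body act edge t (φ.solve act edge t n) (φ.solve act edge t n) =
    φ.solve act edge t n := by
  have := inner_fixed (φ := φ) (act := act) (edge := edge) (t := t) hn (φ.solve act edge t n)
  rwa [solve_fixed hn] at this

end Qualitative

/-- A state in a least fixed point is first reached at some stage of the iteration. -/
theorem exists_stage {S : Type*} {f : (S → Bool) → S → Bool} {s : S} {n : ℕ}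
    (h : f^[n] ⊥ s = true) :
    ∃ j, f^[j + 1] ⊥ s = true := by
  cases n with
  | zero => simp at h
  | succ n => exact ⟨n, h⟩

open scoped Classical in
/-- The stage at which a state enters the iteration towards a least fixed point. -/
noncomputable def stage {S : Type*} (f : (S → Bool) → S → Bool) (s : S) : ℕ :=
  if h : ∃ j, f^[j + 1] ⊥ s = true then Nat.find h else 0

theorem stage_spec {S : Type*} {f : (S → Bool) → S → Bool} {s : S} {n : ℕ} (h : f^[n] ⊥ s = true) :
    f^[stage f s + 1] ⊥ s = true := by
  classical
  have h' := exists_stage h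
  rw [stage, dif_pos h']
  exact Nat.find_spec h'

theorem stage_le {S : Type*} {f : (S → Bool) → S → Bool} {s : S} {j : ℕ}
    (h : f^[j + 1] ⊥ s = true) : stage f s ≤ j := by
  classical
  have h' : ∃ j, f^[j + 1] ⊥ s = true := ⟨j, h⟩
  rw [stage, dif_pos h']
  exact Nat.find_min' h' h

theorem stage_lt {S : Type*} {f : (S → Bool) → S → Bool} {s : S} {j : ℕ} (h : f^[j] ⊥ s = true) :
    stage f s < j := by
  cases j with
  | zero => simp at h
  | succ j => exact Nat.lt_succ_of_le (stage_le h)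

variable {S A : Type*} [Fintype S] (M : MDP S A)

/-- The probability of reaching `T` from `s` under the strategy `σ`. -/
noncomputable abbrev MDP.reachFrom (σ : M.DMSched) (T : Set S) (s : S) : ℝ≥0∞ :=
  (M.induced σ).reachFrom T s

/-- The actions chosen on a set of states extend to a strategy. -/
theorem MDP.exists_sched (C : Set S) (p : S → A → Prop) (h : ∀ s ∈ C, ∃ a, a ∈ M.Act s ∧ p s a) :
    ∃ σ : M.DMSched, ∀ s ∈ C, p s (σ.1 s) := by
  have : ∀ s, ∃ a, a ∈ M.Act s ∧ (s ∈ C → p s a) := by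
    intro s
    by_cases hs : s ∈ C
    · obtain ⟨a, ha, hp⟩ := h s hs
      exact ⟨a, ha, fun _ => hp⟩
    · obtain ⟨a, ha⟩ := M.act_nonempty s
      exact ⟨a, ha, fun h => absurd h hs⟩
  choose σ hσ hp using this
  exact ⟨⟨σ, hσ⟩, fun s hs => hp s hs⟩

open Qualitative

section

variable (T : Set S) {t : S → Bool} (ht : ∀ s, t s = true ↔ s ∈ T) {n : ℕ}
  (hn : Fintype.card S ≤ n)

/-- The outcome of the fixed-point iteration for an MDP. -/
noncomputable abbrev MDP.solve (φ : Qualitative) (t : S → Bool) (n : ℕ) : S → Bool :=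
  φ.solve (fun s a => a ∈ M.Act s) (fun s a s' => M.P s a s' ≠ 0) t n

include ht hn

/-- In the winning region for almost-sure or positive reachability, outside the target, some action
leads with positive probability to a state of an earlier stage; for almost-sure reachability it
also stays in the winning region. -/
theorem MDP.exists_action_of_solve {φ : Qualitative} (hφ : φ.outerGreatest = true) {s : S}
    (hs : M.solve φ t n s = true) (hsT : s ∉ T) :
    ∃ a, a ∈ M.Act s ∧
      (φ = .almostSure → ∀ s', M.P s a s' ≠ 0 → M.solve φ t n s' = true) ∧
      ∃ s', M.P s a s' ≠ 0 ∧ M.solve φ t n s' = true ∧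
        stage (φ.body (fun s a => a ∈ M.Act s) (fun s a s' => M.P s a s' ≠ 0) t (M.solve φ t n))
          s' <
        stage (φ.body (fun s a => a ∈ M.Act s) (fun s a s' => M.P s a s' ≠ 0) t (M.solve φ t n))
          s := by
  set f := φ.body (fun s a => a ∈ M.Act s) (fun s a s' => M.P s a s' ≠ 0) t (M.solve φ t n) with hf
  have hfm : Monotone f := fun _ _ hi => body_mono le_rfl hi
  have hU : f^[n] ⊥ = M.solve φ t n := by
    have := solve_fixed (φ := φ) (act := fun s a => a ∈ M.Act s)
      (edge := fun s a s' => M.P s a s' ≠ 0) (t := t) hn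
    unfold Qualitative.inner at this
    rw [hφ] at this
    exact this
  have hfix : f (M.solve φ t n) = M.solve φ t n := body_solve hn
  have hst : f (f^[stage f s] ⊥) s = true := by
    rw [← Function.iterate_succ_apply' f]
    exact stage_spec (n := n) (by rw [hU]; exact hs)
  have hle : ∀ s', f^[stage f s] ⊥ s' = true → M.solve φ t n s' = true :=
    le_iff_bool.1 (iterate_bot_le hfm hfix.le _)
  cases φ with
  | positive =>
    obtain h | ⟨a, ha, s', hs', h⟩ := pre_positive_iff.1
      (show Qualitative.positive.pre (fun s a => a ∈ M.Act s) (fun s a s' => M.P s a s' ≠ 0) t _ _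
        s = true from hst)
    · exact absurd ((ht s).1 h) hsT
    · exact ⟨a, ha, by simp, s', hs', hle _ h, stage_lt h⟩
  | almostSure =>
    obtain h | ⟨a, ha, h₁, s', hs', h⟩ := pre_almostSure_iff.1
      (show Qualitative.almostSure.pre (fun s a => a ∈ M.Act s) (fun s a s' => M.P s a s' ≠ 0) t _ _
        s = true from hst)
    · exact absurd ((ht s).1 h) hsT
    · exact ⟨a, ha, fun _ => h₁, s', hs', hle _ h, stage_lt h⟩
  | safety => simp [outerGreatest] at hφ
  | unsure => simp [outerGreatest] at hφ

/-- Following the actions that decrease the stage reaches the target with positive probability, and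
the complement of the fixed point is closed under all actions. -/
theorem MDP.solve_positive (s : S) :
    M.solve .positive t n s = true ↔ ∃ σ, 0 < M.reachFrom σ T s := by
  constructor
  · intro hs
    obtain ⟨σ, hσ⟩ := M.exists_sched {s | M.solve .positive t n s = true ∧ s ∉ T} _
      fun s hs => M.exists_action_of_solve T ht hn rfl hs.1 hs.2
    refine ⟨σ, ?_⟩
    induction hr : stage (Qualitative.positive.body (fun s a => a ∈ M.Act s)
      (fun s a s' => M.P s a s' ≠ 0) t (M.solve .positive t n)) s using Nat.strong_induction_on
      generalizing s with
    | _ r ih =>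
      by_cases hsT : s ∈ T
      · simp [reachFrom, MC.reachFrom_of_mem _ _ hsT]
      · obtain ⟨-, s', hs', h, hlt⟩ := hσ s ⟨hs, hsT⟩
        refine pos_iff_ne_zero.2 fun h0 => (ih _ (hr ▸ hlt) s' h rfl).ne' ?_
        exact (M.induced σ).reachFrom_succ_eq_zero hsT h0 hs'
  · rintro ⟨σ, hσ⟩
    by_contra hs
    refine hσ.ne' ((M.induced σ).reachFrom_eq_zero (C := {s | ¬ M.solve .positive t n s = true})
      (fun s hs => ?_) hs)
    have hfix : Qualitative.positive.pre (fun s a => a ∈ M.Act s) (fun s a s' => M.P s a s' ≠ 0) t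
        (M.solve .positive t n) (M.solve .positive t n) = M.solve .positive t n :=
      body_solve (φ := .positive) hn
    have hiff := pre_positive_iff.symm.trans (congrArg (· = true) (congrFun hfix s)).to_iff
    exact ⟨fun h => hs (hiff.1 (Or.inl ((ht s).2 h))), fun s' hs' h =>
      hs (hiff.1 (Or.inr ⟨σ.1 s, σ.2 s, s', hs', h⟩))⟩

/-- The strategy that stays in the winning region and decreases the stage reaches the target almost
surely, by the minimum principle. Conversely, the states from which a strategy reaches the target
almost surely form a post-fixed point of the outer iteration. -/
theorem MDP.solve_almostSure (s : S) :
    M.solve .almostSure t n s = true ↔ ∃ σ, 1 ≤ M.reachFrom σ T s := by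
  constructor
  · intro hs
    obtain ⟨σ, hσ⟩ := M.exists_sched {s | M.solve .almostSure t n s = true ∧ s ∉ T} _
      fun s hs => M.exists_action_of_solve T ht hn rfl hs.1 hs.2
    refine ⟨σ, ?_⟩
    -- among the states minimizing the probability, one of minimal stage must be a target state
    obtain ⟨s₀, hs₀, hmin⟩ := Set.exists_min_image {s | M.solve .almostSure t n s = true}
      (fun s => toLex (M.reachFrom σ T s, stage (Qualitative.almostSure.body
        (fun s a => a ∈ M.Act s) (fun s a s' => M.P s a s' ≠ 0) t (M.solve .almostSure t n)) s))
      (Set.toFinite _) ⟨s, hs⟩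
    have hle : ∀ s, M.solve .almostSure t n s = true → M.reachFrom σ T s₀ ≤ M.reachFrom σ T s := by
      intro s hs
      have := Prod.Lex.le_iff.1 (hmin s hs)
      rcases this with h | h
      · exact h.le
      · exact h.1.le
    by_cases hsT : s₀ ∈ T
    · exact (MC.reachFrom_of_mem _ _ hsT).ge.trans (hle s hs)
    · obtain ⟨h₁, s', hs', h, hlt⟩ := hσ s₀ ⟨hs₀, hsT⟩
      have heq : M.reachFrom σ T s' = M.reachFrom σ T s₀ :=
        (M.induced σ).reachFrom_eq_of_le hsT le_rfl (fun s'' h'' => hle s'' (h₁ rfl s'' h'')) hs'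
      rcases Prod.Lex.le_iff.1 (hmin s' h) with h' | h'
      · exact absurd heq h'.ne'
      · exact absurd hlt (not_lt.2 h'.2)
  · rintro ⟨σ, hσ⟩
    classical
    set act : S → A → Prop := fun s a => a ∈ M.Act s
    set edge : S → A → S → Prop := fun s a s' => M.P s a s' ≠ 0
    let Z : S → Bool := fun s => decide (M.reachFrom σ T s = 1)
    suffices hZ : Z ≤ Qualitative.almostSure.inner act edge t n Z from
      le_iff_bool.1 (le_iterate_top (inner_mono n) hZ n) s
        (decide_eq_true (le_antisymm ((M.induced σ).reachFrom_le_one T s) hσ))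
    rw [le_iff_bool]
    by_contra hcon
    push Not at hcon
    obtain ⟨s, hs, hs'⟩ := hcon
    -- the states in `Z` outside the least fixed point are closed and never reach the target
    have h0 := (M.induced σ).reachFrom_eq_zero (T := T)
      (C := {s | Z s = true ∧ Qualitative.almostSure.inner act edge t n Z s ≠ true})
      (fun s hs => ?_) (s := s) ⟨hs, hs'⟩
    · rw [decide_eq_true_eq, reachFrom, h0] at hs
      exact zero_ne_one hs
    · obtain ⟨hs, hs'⟩ := hs
      rw [← inner_fixed hn] at hs'
      have hsT : s ∉ T := fun h => hs' (pre_almostSure_iff.2 (Or.inl ((ht s).2 h)))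
      have hsucc : ∀ s', edge s (σ.1 s) s' → Z s' = true := fun s' he =>
        decide_eq_true ((M.induced σ).reachFrom_succ_eq_one hsT (of_decide_eq_true hs) he)
      exact ⟨hsT, fun s' he => ⟨hsucc s' he, fun h =>
        hs' (pre_almostSure_iff.2 (Or.inr ⟨σ.1 s, σ.2 s, hsucc, s', he, h⟩))⟩⟩

/-- The states from which the target can be avoided for sure form the greatest closed set of
non-target states. -/
theorem MDP.solve_safety (s : S) :
    M.solve .safety t n s = true ↔ ∃ σ, M.reachFrom σ T s ≤ 0 := by
  have hiff : ∀ ν μ s, Qualitative.safety.pre (fun s a => a ∈ M.Act s)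
      (fun s a s' => M.P s a s' ≠ 0) t ν μ s = true ↔
      s ∉ T ∧ ∃ a, a ∈ M.Act s ∧ ∀ s', M.P s a s' ≠ 0 → ν s' = true := by
    intro ν μ s
    rw [pre_safety_iff, ht]
  constructor
  · intro hs
    have hfix := body_solve (φ := .safety) (act := fun s a => a ∈ M.Act s)
      (edge := fun s a s' => M.P s a s' ≠ 0) (t := t) hn
    have hC : ∀ s ∈ {s | M.solve .safety t n s = true}, s ∉ T ∧ ∃ a, a ∈ M.Act s ∧
        ∀ s', M.P s a s' ≠ 0 → M.solve .safety t n s' = true := fun s hs =>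
      (hiff _ (M.solve .safety t n) s).1 ((congrFun hfix s).trans hs)
    obtain ⟨σ, hσ⟩ := M.exists_sched _ _ fun s hs => (hC s hs).2
    exact ⟨σ, ((M.induced σ).reachFrom_eq_zero (fun s hs => ⟨(hC s hs).1, hσ s hs⟩) hs).le⟩
  · rintro ⟨σ, hσ⟩
    classical
    let Z : S → Bool := fun s => decide (M.reachFrom σ T s = 0)
    refine le_iff_bool.1 (?_ : Z ≤ M.solve .safety t n) s (decide_eq_true (nonpos_iff_eq_zero.1 hσ))
    rw [MDP.solve, ← solve_fixed hn]
    refine le_iterate_top (fun _ _ hi => body_mono le_rfl hi) (le_iff_bool.2 fun s hs => ?_) n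
    have hs0 := of_decide_eq_true hs
    have hsT : s ∉ T := fun h => by
      rw [reachFrom, MC.reachFrom_of_mem _ _ h] at hs0
      exact one_ne_zero hs0
    exact (hiff _ _ s).2 ⟨hsT, σ.1 s, σ.2 s, fun s' he =>
      decide_eq_true ((M.induced σ).reachFrom_succ_eq_zero hsT hs0 he)⟩

/-- The target is missed with positive probability if a set in which it is avoided for sure can be
reached. A strategy from the fixed point is found by induction on the stage of the outer iteration:
within a stage it avoids the target, unless it may enter an earlier stage. Conversely, if
the probability is less than one somewhere outside the fixed point, then the states at which it is
minimal there could be added to the fixed point. -/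
theorem MDP.solve_unsure (s : S) :
    M.solve .unsure t n s = true ↔ ∃ σ, M.reachFrom σ T s < 1 := by
  set act : S → A → Prop := fun s a => a ∈ M.Act s
  set edge : S → A → S → Prop := fun s a s' => M.P s a s' ≠ 0
  have hiff : ∀ ν μ s, Qualitative.unsure.pre act edge t ν μ s = true ↔
      s ∉ T ∧ ∃ a, a ∈ M.Act s ∧ ((∀ s', M.P s a s' ≠ 0 → ν s' = true) ∨
        ∃ s', M.P s a s' ≠ 0 ∧ μ s' = true) := by
    intro ν μ s
    rw [pre_unsure_iff, ht]
  set F := Qualitative.unsure.inner act edge t n with hF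
  have hFm : Monotone F := inner_mono n
  have hX : M.solve .unsure t n = F^[n] ⊥ := rfl
  constructor
  · intro hs
    have hC : ∀ s ∈ {s | M.solve .unsure t n s = true}, s ∉ T ∧ ∃ a, a ∈ M.Act s ∧
        ((∀ s', M.P s a s' ≠ 0 → F^[stage F s + 1] ⊥ s' = true) ∨
          ∃ s', M.P s a s' ≠ 0 ∧ F^[stage F s] ⊥ s' = true) := by
      intro s hs
      have := stage_spec (n := n) (hX ▸ hs : F^[n] ⊥ s = true)
      rw [Function.iterate_succ_apply'] at this ⊢
      rw [hF, ← inner_fixed hn] at this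
      exact (hiff _ _ s).1 this
    obtain ⟨σ, hσ⟩ := M.exists_sched _ _ fun s hs => (hC s hs).2
    refine ⟨σ, lt_of_le_of_ne ((M.induced σ).reachFrom_le_one T s) ?_⟩
    induction hr : stage F s using Nat.strong_induction_on generalizing s with
    | _ r ih =>
      intro h1
      have hsub : ∀ s, F^[r + 1] ⊥ s = true → M.solve .unsure t n s = true :=
        le_iff_bool.1 (iterate_bot_le hFm (solve_fixed hn).le _)
      have h0 := (M.induced σ).reachFrom_eq_zero (T := T)
        (C := {s | F^[r + 1] ⊥ s = true ∧ M.reachFrom σ T s = 1}) ?_ (s := s)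
        ⟨hr ▸ stage_spec (n := n) (hX ▸ hs), h1⟩
      · exact zero_ne_one (h0.symm.trans h1)
      · rintro s ⟨hs, hs1⟩
        have hsX := hsub s hs
        have hsT := (hC s hsX).1
        have hsr : stage F s = r := by
          refine le_antisymm (stage_le hs) (not_lt.1 fun hlt => ?_)
          exact ih _ hlt s hsX rfl hs1
        have hsucc : ∀ s', M.P s (σ.1 s) s' ≠ 0 → M.reachFrom σ T s' = 1 := fun s' he =>
          (M.induced σ).reachFrom_succ_eq_one hsT hs1 he
        refine ⟨hsT, fun s' he => ⟨?_, hsucc s' he⟩⟩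
        rcases hσ s hsX with h | ⟨s'', he'', h⟩
        · exact hsr ▸ h s' he
        · have hlt := stage_lt h
          rw [hsr] at hlt h
          exact absurd (hsucc s'' he'') (ih _ hlt s''
            (hsub s'' (le_iff_bool.1 (iterate_bot_mono hFm (Nat.le_succ r)) _ h)) rfl)
  · rintro ⟨σ, hσ⟩
    classical
    by_contra hs
    -- the probability is minimized outside the fixed point on a closed set without target states
    obtain ⟨s₀, hs₀, hmin⟩ := Set.exists_min_image {s | ¬ M.solve .unsure t n s = true}
      (M.reachFrom σ T) (Set.toFinite _) ⟨s, hs⟩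
    have hfix := fun s => (hiff (M.solve .unsure t n) (M.solve .unsure t n) s).symm.trans
      (congrArg (· = true) (congrFun (body_solve (φ := .unsure) (act := act) (edge := edge)
        (t := t) hn) s)).to_iff
    have hout : ∀ s, ¬ M.solve .unsure t n s = true → s ∉ T →
        ∀ s', M.P s (σ.1 s) s' ≠ 0 → ¬ M.solve .unsure t n s' = true := fun s hs hsT s' he hs' =>
      hs ((hfix s).1 ⟨hsT, σ.1 s, σ.2 s, Or.inr ⟨s', he, hs'⟩⟩)
    let Z : S → Bool := fun s =>
      decide (¬ M.solve .unsure t n s = true ∧ M.reachFrom σ T s = M.reachFrom σ T s₀)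
    have hZ : Z ≤ F (M.solve .unsure t n) := by
      refine le_iterate_top (fun _ _ hi => body_mono le_rfl hi) (le_iff_bool.2 fun s hsZ => ?_) n
      obtain ⟨hsX, hs1⟩ := of_decide_eq_true hsZ
      have hsT : s ∉ T := fun h => by
        rw [reachFrom, MC.reachFrom_of_mem _ _ h] at hs1
        exact absurd (hs1.le.trans (hmin _ hs)) (not_le.2 hσ)
      refine (hiff _ _ s).2 ⟨hsT, σ.1 s, σ.2 s, Or.inl fun s' he => decide_eq_true
        ⟨hout s hsX hsT s' he, ?_⟩⟩
      exact (M.induced σ).reachFrom_eq_of_le hsT hs1.le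
        (fun s'' he'' => hmin s'' (hout s hsX hsT s'' he'')) he
    exact hs₀ ((congrFun (solve_fixed hn) s₀).symm.trans
      (le_iff_bool.1 hZ s₀ (decide_eq_true ⟨hs₀, rfl⟩)))

/-- The fixed-point iteration solves qualitative reachability for existentially quantified
strategies. -/
theorem MDP.solve_iff (φ : Qualitative) (s : S) :
    M.solve φ t n s = true ↔ ∃ σ, φ.Holds (M.reachFrom σ T s) := by
  cases φ
  · exact M.solve_positive T ht hn s
  · exact M.solve_unsure T ht hn s
  · exact M.solve_safety T ht hn s
  · exact M.solve_almostSure T ht hn s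

end

/-- The negation of a qualitative condition. -/
def Qualitative.dual : Qualitative → Qualitative
  | positive => safety
  | safety => positive
  | unsure => almostSure
  | almostSure => unsure

theorem Qualitative.dual_holds (φ : Qualitative) (p : ℝ≥0∞) : φ.dual.Holds p ↔ ¬ φ.Holds p := by
  cases φ <;> simp [dual, Holds, pos_iff_ne_zero]

/-- The outcome of the fixed-point iteration, adapted to the quantifier over strategies: a
condition holds for all strategies if its negation is satisfied by none. -/
noncomputable def Quantifier.solve {S A : Type*} (Q : Quantifier) (φ : Qualitative)
    (act : S → A → Prop) (edge : S → A → S → Prop) (t : S → Bool) (n : ℕ) (s : S) : Bool :=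
  match Q with
  | ex => φ.solve act edge t n s
  | all => !φ.dual.solve act edge t n s

theorem MDP.quantifier_solve_iff (T : Set S) {t : S → Bool} (ht : ∀ s, t s = true ↔ s ∈ T) {n : ℕ}
    (hn : Fintype.card S ≤ n) (Q : Quantifier) (φ : Qualitative) :
    Q.solve φ (fun s a => a ∈ M.Act s) (fun s a s' => M.P s a s' ≠ 0) t n M.init = true ↔
      Q.Holds fun σ : M.DMSched => φ.Holds ((M.induced σ).reachProb T) := by
  cases Q
  · exact M.solve_iff T ht hn φ M.init
  · have := M.solve_iff T ht hn φ.dual M.init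
    simp only [dual_holds] at this
    simp only [Quantifier.solve, Quantifier.Holds, Bool.not_eq_true']
    rw [← Bool.not_eq_true, this]
    push Not
    rfl

end ParamMDP

/-! ### Valuations up to the transitions that vanish -/

namespace ParamMDP

open scoped ENNReal
open MvPolynomial (aeval)

/-- What matters about the value of a parameter: whether it is `0` (`some false`), `1`
(`some true`), or neither (`none`). -/
noncomputable def kind (r : ℝ) : Option Bool :=
  if r = 0 then some false else if r = 1 then some true else none

/-- A value in the unit interval of a given kind. -/
noncomputable def kindVal : Option Bool → ℝ
  | some false => 0
  | some true => 1
  | none => 1 / 2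

@[simp]
theorem kind_kindVal (o : Option Bool) : kind (kindVal o) = o := by
  rcases o with _ | _ | _ <;> norm_num [kind, kindVal]

theorem kind_eq_zero_iff {r : ℝ} : kind r = some false ↔ r = 0 := by
  unfold kind
  split_ifs <;> simp_all

theorem kind_eq_one_iff {r : ℝ} : kind r = some true ↔ r = 1 := by
  unfold kind
  split_ifs <;> simp_all

theorem kindVal_mem (o : Option Bool) : 0 ≤ kindVal o ∧ kindVal o ≤ 1 := by
  rcases o with _ | _ | _ <;> norm_num [kindVal]

namespace PMDP

variable {S A X : Type*} [Fintype S] {M : PMDP S A X}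

theorem mem_wdVal_of_unit (hM : M.IsSimple) {v : X → ℝ} (hv : ∀ x, 0 ≤ v x ∧ v x ≤ 1) :
    v ∈ M.wdVal := by
  refine ⟨fun s a ha s' => ?_, fun s a ha => ?_⟩
  · rcases hM.1 s a ha s' with ⟨x, h⟩ | ⟨x, h⟩ | ⟨q, hq, h⟩
    · simpa [h] using (hv x).1
    · simpa [h] using (hv x).2
    · simpa [h] using hq
  · rw [← map_sum, hM.2 s a ha, map_one]

theorem aeval_eq_zero_iff_of_kind (hM : M.IsSimple) {v w : X → ℝ}
    (h : ∀ x, kind (v x) = kind (w x)) {s : S} {a : A} (ha : a ∈ M.Act s) (s' : S) :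
    aeval v (M.P s a s') = 0 ↔ aeval w (M.P s a s') = 0 := by
  rcases hM.1 s a ha s' with ⟨x, hx⟩ | ⟨x, hx⟩ | ⟨q, hq, hx⟩
  · simp [hx, ← kind_eq_zero_iff, h]
  · simp [hx, sub_eq_zero, eq_comm (a := (1 : ℝ)), ← kind_eq_one_iff, h]
  · simp [hx]

theorem vanishing_eq_of_kind (hM : M.IsSimple) {v w : X → ℝ} (h : ∀ x, kind (v x) = kind (w x)) :
    M.vanishing v = M.vanishing w := by
  ext ⟨s, a, s'⟩
  refine and_congr_right fun ha => and_congr_right fun _ => ?_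
  exact aeval_eq_zero_iff_of_kind hM h ha s'

/-- The kinds of the parameter values determine the transitions that vanish, so there are at most
`3 ^ |X|` sets of vanishing transitions. -/
theorem exists_partition [Fintype X] (hM : M.IsSimple) :
    ∃ 𝓡 : Finset (Set (X → ℝ)), 𝓡.card ≤ 3 ^ Fintype.card X ∧
      (∀ R ∈ 𝓡, R.Nonempty ∧ M.IsMaxGraphConsistent R) ∧
      (𝓡 : Set (Set (X → ℝ))).PairwiseDisjoint id ∧
      ⋃₀ (𝓡 : Set (Set (X → ℝ))) = M.wdVal := by
  classical
  let cls : (X → Option Bool) → Set (X → ℝ) := fun τ =>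
    {v | v ∈ M.wdVal ∧ M.vanishing v = M.vanishing fun x => kindVal (τ x)}
  refine ⟨Finset.univ.image cls, ?_, ?_, ?_, ?_⟩
  · refine Finset.card_image_le.trans ?_
    simp
  · simp only [Finset.mem_image, Finset.mem_univ, true_and, forall_exists_index,
      forall_apply_eq_imp_iff]
    intro τ
    have hτ : (fun x => kindVal (τ x)) ∈ cls τ :=
      ⟨mem_wdVal_of_unit hM fun x => kindVal_mem _, rfl⟩
    refine ⟨⟨_, hτ⟩, ⟨fun v hv => hv.1, fun v hv w hw => hv.2.trans hw.2.symm⟩,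
      fun R' hR' hsub => ?_⟩
    exact Set.Subset.antisymm (fun v hv => ⟨hR'.1 hv, hR'.2 v hv _ (hsub hτ)⟩) hsub
  · intro R hR R' hR' hne
    simp only [Finset.coe_image, Finset.coe_univ, Set.image_univ, Set.mem_range] at hR hR'
    obtain ⟨τ, rfl⟩ := hR
    obtain ⟨τ', rfl⟩ := hR'
    refine Set.disjoint_left.2 fun v hv hv' => hne ?_
    have h : M.vanishing (fun x => kindVal (τ x)) = M.vanishing fun x => kindVal (τ' x) :=
      hv.2.symm.trans hv'.2
    simp only [cls, h]
  · ext v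
    simp only [Finset.coe_image, Finset.coe_univ, Set.image_univ, Set.sUnion_range, Set.mem_iUnion]
    refine ⟨fun ⟨τ, hv⟩ => hv.1, fun hv => ⟨fun x => kind (v x), hv, ?_⟩⟩
    exact vanishing_eq_of_kind hM fun x => (kind_kindVal _).symm

end PMDP

/-! ### Reducing the problems to finitely many fixed-point computations -/

/-- Only the transitions of available actions matter for the fixed-point iteration. -/
theorem Quantifier.solve_congr {S A : Type*} {Q : Quantifier} {φ : Qualitative}
    {act : S → A → Prop} {edge edge' : S → A → S → Prop} {t : S → Bool} {n : ℕ}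
    (h : ∀ s a, act s a → ∀ s', edge s a s' ↔ edge' s a s') :
    Q.solve φ act edge t n = Q.solve φ act edge' t n := by
  have hpre : ∀ φ : Qualitative, φ.pre act edge t = φ.pre act edge' t := by
    intro φ
    funext ν μ s
    unfold Qualitative.pre
    congr 2
    refine propext (exists_congr fun a => and_congr_right fun ha => ?_)
    rw [show edge s a = edge' s a from funext fun s' => propext (h s a ha s')]
  have hsolve : ∀ φ : Qualitative, φ.solve act edge t n = φ.solve act edge' t n := by
    intro φ
    unfold Qualitative.solve Qualitative.inner Qualitative.body
    simp only [hpre]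
  funext s
  cases Q <;> simp only [Quantifier.solve, hsolve]

/-- Whether a label has a positive value, given the kinds of the parameter values. -/
def Label.pos {k : ℕ} (τ : ℕ → Option Bool) : Label k → Bool
  | .const a _ => a != 0
  | .param x => τ x != some false
  | .coparam x => τ x != some true

theorem Label.pos_iff {k : ℕ} {τ : ℕ → Option Bool} {v : Fin k → ℝ}
    (h : ∀ x : Fin k, τ x = kind (v x)) (l : Label k) :
    l.pos τ = true ↔ aeval v l.toPoly ≠ 0 := by
  cases l with
  | const a b => simp [pos, toPoly]
  | param x => simp [pos, toPoly, h, kind_eq_zero_iff]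
  | coparam x => simp [pos, toPoly, h, kind_eq_one_iff, sub_eq_zero, eq_comm (a := (1 : ℝ))]

/-- Positivity of the reachability probability is inherited from smaller supports. -/
theorem MC.reachProb_pos_mono {S : Type*} [Fintype S] {D D' : MC S} {T : Set S}
    (hi : D.init = D'.init) (h : ∀ s s', D.P s s' ≠ 0 → D'.P s s' ≠ 0) (hD : 0 < D.reachProb T) :
    0 < D'.reachProb T := by
  by_contra h0
  refine hD.ne' (D.reachFrom_eq_zero (C := {s | D'.reachFrom T s = 0}) (fun s hs => ?_)
    (s := D.init) ?_)
  · have hsT : s ∉ T := fun hsT => one_ne_zero ((D'.reachFrom_of_mem T hsT).symm.trans hs)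
    exact ⟨hsT, fun s' hs' => D'.reachFrom_succ_eq_zero hsT hs (h s s' hs')⟩
  · rw [hi]
    exact nonpos_iff_eq_zero.1 (not_lt.1 h0)

namespace SimpleInstance

variable (I : SimpleInstance)

/-- The answer to the reachability question for one kind of every parameter value. -/
noncomputable def answer (Q : Quantifier) (φ : Qualitative) (τ : ℕ → Option Bool) : Bool :=
  Q.solve φ (fun s a => ∃ f, I.row s a = some f)
    (fun s a s' => ∃ f, I.row s a = some f ∧ (f s').pos τ = true)
    (fun s => decide (s ∈ I.target)) I.n I.init

variable {I}

theorem answer_iff {v : Fin I.k → ℝ} (hv : v ∈ I.toPMDP.wdVal) {τ : ℕ → Option Bool}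
    (h : ∀ s a f, I.row s a = some f → ∀ s', (f s').pos τ = true ↔ aeval v (f s').toPoly ≠ 0)
    (Q : Quantifier) (φ : Qualitative) :
    I.answer Q φ τ = true ↔ Q.Holds fun σ : (I.toPMDP.instantiate v hv).DMSched =>
      φ.Holds (((I.toPMDP.instantiate v hv).induced σ).reachProb (I.target : Set (Fin I.n))) := by
  rw [← MDP.quantifier_solve_iff (I.toPMDP.instantiate v hv) (I.target : Set (Fin I.n))
    (t := fun s => decide (s ∈ I.target)) (by simp) (by simp : Fintype.card (Fin I.n) ≤ I.n)]
  unfold answer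
  rw [Quantifier.solve_congr]
  · rfl
  · rintro s a ⟨f, hf⟩ s'
    simp [PMDP.instantiate, toPMDP, hf, h s a f hf s']

theorem answer_iff_of_kind {v : Fin I.k → ℝ} (hv : v ∈ I.toPMDP.wdVal) {τ : ℕ → Option Bool}
    (h : ∀ x : Fin I.k, τ x = kind (v x)) (Q : Quantifier) (φ : Qualitative) :
    I.answer Q φ τ = true ↔ Q.Holds fun σ : (I.toPMDP.instantiate v hv).DMSched =>
      φ.Holds (((I.toPMDP.instantiate v hv).induced σ).reachProb (I.target : Set (Fin I.n))) :=
  answer_iff hv (fun _ _ f _ s' => (f s').pos_iff h) Q φ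

theorem unit_mem_wdVal {τ : ℕ → Option Bool} :
    (fun x : Fin I.k => kindVal (τ x)) ∈ I.toPMDP.wdVal :=
  PMDP.mem_wdVal_of_unit I.toPMDP_isSimple fun _ => kindVal_mem _

theorem half_mem_gpVal : (fun _ : Fin I.k => kindVal none) ∈ I.toPMDP.gpVal := by
  refine ⟨unit_mem_wdVal (τ := fun _ => none), Set.eq_empty_of_forall_notMem ?_⟩
  rintro ⟨s, a, s'⟩ ⟨ha, hne, h0⟩
  rcases I.toPMDP_isSimple.1 s a ha s' with ⟨x, hx⟩ | ⟨x, hx⟩ | ⟨q, hq, hx⟩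
  · norm_num [hx, kindVal] at h0
  · norm_num [hx, kindVal] at h0
  · simp_all

/-- All graph-preserving valuations lead to the same supports, and the valuation with constant value
`1 / 2` is one of them. -/
theorem reach_gpVal_iff (Q : Quantifier) (φ : Qualitative) :
    I.toPMDP.Reach (I.target : Set (Fin I.n)) I.toPMDP.gpVal Q φ ↔
      I.answer Q φ (fun _ => none) = true := by
  constructor
  · rintro ⟨v, hv, hgp, h⟩
    refine (answer_iff hv (fun s a f hf s' => ?_) Q φ).2 h
    rw [Label.pos_iff (v := fun _ => kindVal none) (by simp), not_iff_not]
    have hP : I.toPMDP.P s a s' = (f s').toPoly := by simp [toPMDP, hf]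
    rw [← hP]
    have key : ∀ w ∈ I.toPMDP.gpVal, aeval w (I.toPMDP.P s a s') = 0 ↔ I.toPMDP.P s a s' = 0 := by
      intro w hw
      refine ⟨fun h0 => ?_, fun h0 => by rw [h0, map_zero]⟩
      by_contra hne
      exact Set.eq_empty_iff_forall_notMem.1 hw.2 (s, a, s') ⟨⟨f, hf⟩, hne, h0⟩
    rw [key _ half_mem_gpVal, key _ hgp]
  · intro h
    exact ⟨_, half_mem_gpVal.1, half_mem_gpVal,
      (answer_iff_of_kind half_mem_gpVal.1 (by simp) Q φ).1 h⟩

/-- The supports under graph-preserving valuations are the largest ones, so these valuations are the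
best ones for positive reachability. -/
theorem reach_positive_iff {R : Set (Fin I.k → ℝ)} (hR : I.toPMDP.gpVal ⊆ R) (Q : Quantifier) :
    I.toPMDP.Reach (I.target : Set (Fin I.n)) R Q .positive ↔
      I.answer Q .positive (fun _ => none) = true := by
  constructor
  · rintro ⟨v, hv, -, h⟩
    refine (answer_iff_of_kind half_mem_gpVal.1 (by simp) Q _).2 ?_
    have key : ∀ σ : (I.toPMDP.instantiate v hv).DMSched,
        0 < ((I.toPMDP.instantiate v hv).induced σ).reachProb (I.target : Set (Fin I.n)) →
        0 < ((I.toPMDP.instantiate _ half_mem_gpVal.1).induced σ).reachProb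
          (I.target : Set (Fin I.n)) := by
      intro σ
      refine MC.reachProb_pos_mono rfl fun s s' hne h0 => hne ?_
      have hP : I.toPMDP.P s (σ.1 s) s' = 0 := by
        by_contra hP
        exact Set.eq_empty_iff_forall_notMem.1 half_mem_gpVal.2 (s, σ.1 s, s') ⟨σ.2 s, hP, h0⟩
      simp [MDP.induced, PMDP.instantiate, hP]
    cases Q
    · exact h.imp key
    · exact fun σ => key σ (h σ)
  · intro h
    exact ⟨_, half_mem_gpVal.1, hR half_mem_gpVal,
      (answer_iff_of_kind half_mem_gpVal.1 (by simp) Q _).1 h⟩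

/-- Kinds for all parameters from kinds for the parameters below `K`. -/
def extendKind {K : ℕ} (τ : Fin K → Option Bool) (x : ℕ) : Option Bool :=
  if h : x < K then τ ⟨x, h⟩ else none

theorem extendKind_of_le {K : ℕ} (τ : Fin K → Option Bool) {x : ℕ} (h : K ≤ x) :
    extendKind τ x = none := dif_neg (not_lt.2 h)

theorem extendKind_of_lt {K : ℕ} (τ : Fin K → Option Bool) {x : ℕ} (h : x < K) :
    extendKind τ x = τ ⟨x, h⟩ := dif_pos h

theorem reach_wdVal_iff {K : ℕ} (hK : I.k ≤ K) (Q : Quantifier) (φ : Qualitative) :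
    I.toPMDP.Reach (I.target : Set (Fin I.n)) I.toPMDP.wdVal Q φ ↔
      ∃ τ : Fin K → Option Bool, I.answer Q φ (extendKind τ) = true := by
  constructor
  · rintro ⟨v, hv, -, h⟩
    refine ⟨fun x => if h : x.1 < I.k then kind (v ⟨x, h⟩) else none,
      (answer_iff_of_kind hv (fun x => ?_) Q φ).2 h⟩
    rw [extendKind_of_lt _ (x.2.trans_le hK)]
    simp
  · rintro ⟨τ, h⟩
    exact ⟨_, unit_mem_wdVal, unit_mem_wdVal,
      (answer_iff_of_kind (unit_mem_wdVal (τ := extendKind τ)) (by simp) Q φ).1 h⟩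

theorem reach_boolVal_iff {K : ℕ} (hK : I.k ≤ K) (Q : Quantifier) (φ : Qualitative) :
    I.toPMDP.Reach (I.target : Set (Fin I.n)) I.toPMDP.boolVal Q φ ↔
      ∃ τ : Fin K → Bool, I.answer Q φ (extendKind fun x => some (τ x)) = true := by
  constructor
  · rintro ⟨v, hv, hb, h⟩
    refine ⟨fun x => if h : x.1 < I.k then decide (v ⟨x, h⟩ = 1) else false,
      (answer_iff_of_kind hv (fun x => ?_) Q φ).2 h⟩
    rw [extendKind_of_lt _ (x.2.trans_le hK)]
    rcases hb.2 x with hx | hx <;> simp [hx, kind]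
  · rintro ⟨τ, h⟩
    refine ⟨_, unit_mem_wdVal, ⟨unit_mem_wdVal, fun x => ?_⟩,
      (answer_iff_of_kind (unit_mem_wdVal (τ := extendKind fun x => some (τ x))) (by simp) Q φ).1 h⟩
    beta_reduce
    rw [extendKind_of_lt _ (x.2.trans_le hK)]
    cases τ ⟨x, x.2.trans_le hK⟩ <;> simp [kindVal]

end SimpleInstance

end ParamMDP

/-! ### The stacks of the decision procedure -/

namespace ParamMDP

open StackProg StackProg.Cmd

/-- The data kept for every state: whether it is a target state, and whether it belongs to the
current approximations of the outer and of the inner fixed point. -/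
structure Cell where
  target : Bool
  outer : Bool
  inner : Bool

/-- The tokens of the internal representation of the transitions. In reading order, every state
contributes `state`, followed by `row` and one token `edge` per successor state for each of its
available actions. The token `edge b` says for every index `j : ι`, which stands for a choice of the
kinds of the parameter values, whether the transition has a positive probability. -/
inductive Tok (ι : Type)
  | state
  | row
  | edge (b : ι → Bool)

instance : Finite Cell :=
  Finite.of_injective (fun c : Cell => (c.target, c.outer, c.inner)) fun c d h => by
    cases c; cases d; simp_all

instance {ι : Type} [Finite ι] : Finite (Tok ι) :=
  Finite.of_surjective (α := Option (Option (ι → Bool)))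
    (fun | none => .state | some none => .row | some (some b) => .edge b)
    fun | .state => ⟨none, rfl⟩ | .row => ⟨some none, rfl⟩ | .edge b => ⟨some (some b), rfl⟩

/-- The eight input symbols. -/
def symbolOfFin : Fin 8 → Symbol :=
  ![.zero, .one, .sep, .const, .param, .coparam, .enabled, .disabled]

instance : Finite Symbol :=
  Finite.of_surjective symbolOfFin fun
    | .zero => ⟨0, rfl⟩ | .one => ⟨1, rfl⟩ | .sep => ⟨2, rfl⟩ | .const => ⟨3, rfl⟩
    | .param => ⟨4, rfl⟩ | .coparam => ⟨5, rfl⟩ | .enabled => ⟨6, rfl⟩ | .disabled => ⟨7, rfl⟩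

/-- The names of the stacks: the input; unary counters for the number of states (twice), of actions,
and for the index of the initial state, each with a partner that holds the part already counted; the
transitions and the states' data, each with a partner that holds the part already read; the two
flags of the current row, the flag of the current state, and the flags computed so far; a stack that
is non-empty once some choice of kinds has given a positive answer; the output. -/
inductive Stk
  | inp | n₁ | d₁ | n₂ | d₂ | m | dm | ini | dini | toks | toks' | cells | cells' | row | acc | new
  | ans | out
deriving DecidableEq

instance : Fintype Stk where
  elems := {.inp, .n₁, .d₁, .n₂, .d₂, .m, .dm, .ini, .dini, .toks, .toks', .cells, .cells', .row,
    .acc, .new, .ans, .out}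
  complete k := by cases k <;> decide

/-- The alphabets of the stacks. -/
def Alph (ι : Type) : Stk → Type
  | .inp => Symbol
  | .n₁ | .d₁ | .n₂ | .d₂ | .m | .dm | .ini | .dini | .ans => Unit
  | .toks | .toks' => Tok ι
  | .cells | .cells' => Cell
  | .row => Bool × Bool
  | .acc | .new | .out => Bool

instance {ι : Type} [Finite ι] : ∀ k, Finite (Alph ι k)
  | .inp => inferInstanceAs (Finite Symbol)
  | .n₁ | .d₁ | .n₂ | .d₂ | .m | .dm | .ini | .dini | .ans => inferInstanceAs (Finite Unit)
  | .toks | .toks' => inferInstanceAs (Finite (Tok ι))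
  | .cells | .cells' => inferInstanceAs (Finite Cell)
  | .row => inferInstanceAs (Finite (Bool × Bool))
  | .acc | .new | .out => inferInstanceAs (Finite Bool)

/-- The contents of all stacks. -/
structure St (ι : Type) where
  inp : List Symbol := []
  n₁ : List Unit := []
  d₁ : List Unit := []
  n₂ : List Unit := []
  d₂ : List Unit := []
  m : List Unit := []
  dm : List Unit := []
  ini : List Unit := []
  dini : List Unit := []
  toks : List (Tok ι) := []
  toks' : List (Tok ι) := []
  cells : List Cell := []
  cells' : List Cell := []
  row : List (Bool × Bool) := []
  acc : List Bool := []
  new : List Bool := []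
  ans : List Unit := []
  out : List Bool := []

namespace St

variable {ι : Type}

/-- The content of a stack. -/
def get (s : St ι) : ∀ k, List (Alph ι k)
  | .inp => s.inp
  | .n₁ => s.n₁
  | .d₁ => s.d₁
  | .n₂ => s.n₂
  | .d₂ => s.d₂
  | .m => s.m
  | .dm => s.dm
  | .ini => s.ini
  | .dini => s.dini
  | .toks => s.toks
  | .toks' => s.toks'
  | .cells => s.cells
  | .cells' => s.cells'
  | .row => s.row
  | .acc => s.acc
  | .new => s.new
  | .ans => s.ans
  | .out => s.out

/-- Replace the content of a stack. -/
def set (s : St ι) : ∀ k, List (Alph ι k) → St ι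
  | .inp, l => { s with inp := l }
  | .n₁, l => { s with n₁ := l }
  | .d₁, l => { s with d₁ := l }
  | .n₂, l => { s with n₂ := l }
  | .d₂, l => { s with d₂ := l }
  | .m, l => { s with m := l }
  | .dm, l => { s with dm := l }
  | .ini, l => { s with ini := l }
  | .dini, l => { s with dini := l }
  | .toks, l => { s with toks := l }
  | .toks', l => { s with toks' := l }
  | .cells, l => { s with cells := l }
  | .cells', l => { s with cells' := l }
  | .row, l => { s with row := l }
  | .acc, l => { s with acc := l }
  | .new, l => { s with new := l }
  | .ans, l => { s with ans := l }
  | .out, l => { s with out := l }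

theorem update_get (s : St ι) (k : Stk) (l : List (Alph ι k)) :
    Function.update s.get k l = (s.set k l).get := by
  funext k'
  by_cases h : k' = k
  · subst h
    rw [Function.update_self]
    cases k' <;> rfl
  · rw [Function.update_of_ne h]
    cases k <;> cases k' <;> first | rfl | exact absurd rfl h

theorem get_injective : Function.Injective (get (ι := ι)) := by
  intro s s' h
  have := congrFun h
  cases s; cases s'
  congr
  exacts [this .inp, this .n₁, this .d₁, this .n₂, this .d₂, this .m, this .dm, this .ini,
    this .dini, this .toks, this .toks', this .cells, this .cells', this .row, this .acc,
    this .new, this .ans, this .out]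

@[simp]
theorem get_set (s : St ι) (k : Stk) (l : List (Alph ι k)) : (s.set k l).get k = l := by
  rw [← update_get, Function.update_self]

@[simp]
theorem set_set (s : St ι) (k : Stk) (l l' : List (Alph ι k)) :
    (s.set k l).set k l' = s.set k l' := by
  apply get_injective
  simp only [← update_get, Function.update_idem]

@[simp]
theorem set_get (s : St ι) (k : Stk) : s.set k (s.get k) = s := by
  apply get_injective
  rw [← update_get, Function.update_eq_self]

theorem get_set_of_ne (s : St ι) {k k' : Stk} (h : k' ≠ k) (l : List (Alph ι k)) :
    (s.set k l).get k' = s.get k' := by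
  rw [← update_get, Function.update_of_ne h]

theorem set_comm (s : St ι) {k k' : Stk} (h : k ≠ k') (l : List (Alph ι k))
    (l' : List (Alph ι k')) : (s.set k l).set k' l' = (s.set k' l').set k l := by
  apply get_injective
  simp only [← update_get, Function.update_comm h]

end St

variable {ι : Type}

/-- `Run c s s' t` means that `c` transforms `s` into `s'` in at most `t` steps. -/
def Run (c : Cmd (Alph ι)) (s s' : St ι) (t : ℕ) : Prop := Does c s.get s'.get t

section Rules

variable {c d : Cmd (Alph ι)} {s s' s'' : St ι} {t t' : ℕ} {k : Stk}

theorem Run.mono (h : Run c s s' t) (ht : t ≤ t') : Run c s s' t' := Does.mono h ht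

theorem run_skip (s : St ι) : Run skip s s 1 := does_skip _

theorem run_push (k : Stk) (x : Alph ι k) (s : St ι) :
    Run (push k x) s (s.set k (x :: s.get k)) 1 := by
  unfold Run
  rw [← St.update_get]
  exact does_push k x _

theorem Run.seq (h : Run c s s' t) (h' : Run d s' s'' t') : Run (c.seq d) s s'' (t + t') :=
  Does.seq h h'

theorem Run.pop_cons {e : Cmd (Alph ι)} {f : Alph ι k → Cmd (Alph ι)} {x : Alph ι k}
    {l : List (Alph ι k)} (hs : s.get k = x :: l) (h : Run (f x) (s.set k l) s' t) :
    Run (pop k e f) s s' (1 + t) :=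
  Does.pop_cons hs (by rwa [St.update_get])

theorem Run.pop_nil {e : Cmd (Alph ι)} {f : Alph ι k → Cmd (Alph ι)} (hs : s.get k = [])
    (h : Run e s s' t) : Run (pop k e f) s s' (1 + t) :=
  Does.pop_nil hs h

/-- `Loops k isEnd f s L s' t` means that the iterations of a loop with body `f` that consume the
symbols `L` transform `s` into `s'`, up to the stack `k` of the loop, in at most `t` steps. -/
def Loops (k : Stk) (isEnd : Alph ι k → Bool) (f : Alph ι k → Cmd (Alph ι)) (s : St ι)
    (L : List (Alph ι k)) (s' : St ι) (t : ℕ) : Prop :=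
  ∀ L' s'' t', Run (loop k isEnd f) (s'.set k L') s'' t' →
    Run (loop k isEnd f) (s.set k (L ++ L')) s'' (t + t')

variable {isEnd : Alph ι k → Bool} {f : Alph ι k → Cmd (Alph ι)} {L L' : List (Alph ι k)}

theorem loops_nil (s : St ι) : Loops k isEnd f s [] s 0 := fun _ _ _ h => by simpa using h

theorem Loops.append (h : Loops k isEnd f s L s' t) (h' : Loops k isEnd f s' L' s'' t') :
    Loops k isEnd f s (L ++ L') s'' (t + t') := fun L'' _ _ h'' => by
  rw [List.append_assoc, add_assoc]
  exact h _ _ _ (h' _ _ _ h'')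

theorem Loops.mono (h : Loops k isEnd f s L s' t) (ht : t ≤ t') : Loops k isEnd f s L s' t' :=
  fun L' s'' t'' h' => (h L' s'' t'' h').mono (by lia)

theorem Loops.congr {s₁ s₁' : St ι} {L₁ : List (Alph ι k)} {t₁ : ℕ} (h : Loops k isEnd f s L s' t)
    (hs : s = s₁) (hL : L = L₁) (hs' : s' = s₁') (ht : t ≤ t₁) : Loops k isEnd f s₁ L₁ s₁' t₁ := by
  subst hs hL hs'
  exact h.mono ht

theorem loops_single {x : Alph ι k} (hx : isEnd x = false)
    (h : ∀ l, Run (f x) (s.set k l) (s'.set k l) t) : Loops k isEnd f s [x] s' (1 + t) :=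
  fun L' s'' t'' h' => Does.loop_cons (x := x) (l := L') (by simp) hx
    (by rw [St.update_get, St.set_set]; exact h L') h'

theorem Loops.run (h : Loops k isEnd f s L s' t) (hs : s.get k = L) :
    Run (loop k isEnd f) s (s'.set k []) (t + 1) := by
  have := h [] (s'.set k []) 1 (does_loop_nil (by simp))
  rwa [List.append_nil, ← hs, St.set_get] at this

theorem Loops.run_exit (h : Loops k isEnd f s L s' t) {x : Alph ι k} {l : List (Alph ι k)}
    (hx : isEnd x = true) (hs : s.get k = L ++ x :: l) :
    Run (loop k isEnd f) s (s'.set k l) (t + 1) := by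
  have := h (x :: l) (s'.set k l) 1 (by
    have := does_loop_exit (isEnd := isEnd) (f := f) (S := (s'.set k (x :: l)).get) (x := x)
      (l := l) (by simp) hx
    rwa [St.update_get, St.set_set] at this)
  rwa [← hs, St.set_get] at this

/-- The effect of the iterations of a loop, when the effect of the `i`-th iteration is known. -/
theorem loops_of_seq (a : ℕ → St ι) (B : ℕ) (L : List (Alph ι k)) (hx : ∀ x ∈ L, isEnd x = false)
    (h : ∀ i (hi : i < L.length), ∀ l, Run (f L[i]) ((a i).set k l) ((a (i + 1)).set k l) B) :
    Loops k isEnd f (a 0) L (a L.length) (L.length * (1 + B)) := by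
  induction L generalizing a with
  | nil => simpa using loops_nil (a 0)
  | cons x L ih =>
    have h₁ := loops_single (k := k) (isEnd := isEnd) (f := f) (x := x) (s := a 0) (s' := a 1)
      (hx x (by simp)) (h 0 (by simp))
    have h₂ := ih (fun i => a (i + 1)) (fun y hy => hx y (by simp [hy]))
      (fun i hi => h (i + 1) (by simpa using hi))
    refine (h₁.append h₂).mono ?_
    rw [List.length_cons]
    ring_nf
    lia

/-- Run `c` as often as the counter `k` says, using the stack `k'` to restore the counter. -/
def times (k k' : Stk) (x : Alph ι k) (x' : Alph ι k') (c : Cmd (Alph ι)) : Cmd (Alph ι) :=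
  (loop k (fun _ => false) fun _ => (push k' x').seq c).seq
    (loop k' (fun _ => false) fun _ => push k x)

/-- The state after `i` rounds is `a i`, up to the two counters, on which `c` must not depend. -/
theorem run_times {k k' : Stk} (hk : k ≠ k') (x : Alph ι k) (x' : Alph ι k') (n : ℕ)
    (a : ℕ → St ι) (B : ℕ)
    (h : ∀ i < n, ∀ l l', Run c (((a i).set k l).set k' l') (((a (i + 1)).set k l).set k' l') B)
    (h0 : (a 0).get k = List.replicate n x) (h0' : (a 0).get k' = []) :
    Run (times k k' x x' c) (a 0) (((a n).set k (List.replicate n x)).set k' [])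
      (n * (B + 4) + 2) := by
  have h₁ := loops_of_seq (k := k) (isEnd := fun _ => false) (f := fun _ => (push k' x').seq c)
    (fun i => (a i).set k' (List.replicate i x')) (1 + B) (List.replicate n x) (by simp)
    (fun i hi l => by
      have hi' : i < n := by simpa using hi
      have := (run_push k' x' (((a i).set k' (List.replicate i x')).set k l)).seq
        (s'' := ((a (i + 1)).set k' (List.replicate (i + 1) x')).set k l) (d := c) (t' := B) (by
          rw [St.get_set_of_ne _ hk.symm, St.get_set, ← List.replicate_succ,
            St.set_comm _ hk.symm, St.set_comm _ hk.symm, St.set_set]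
          exact h i hi' l _)
      exact this)
  have h₂ := h₁.run (by rw [St.get_set_of_ne _ hk, h0])
  have h₃ := loops_of_seq (k := k') (isEnd := fun _ => false) (f := fun _ => push k x)
    (fun i => ((a n).set k (List.replicate i x)).set k' (List.replicate n x')) 1
    (List.replicate n x') (by simp)
    (fun i hi l => by
      have := run_push k x (((a n).set k (List.replicate i x)).set k' l)
      rw [St.get_set_of_ne _ hk, St.get_set, ← List.replicate_succ, ← St.set_comm _ hk,
        St.set_set] at this
      simpa using this)
  have h₄ := h₃.run (k := k') (by simp)
  rw [List.length_replicate, St.set_comm _ hk.symm] at h₂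
  rw [List.length_replicate, St.set_set] at h₄
  have h0 : (a 0).set k' (List.replicate 0 x') = a 0 := by
    rw [List.replicate_zero, ← h0', St.set_get]
  rw [h0] at h₂
  exact (h₂.seq h₄).mono (by ring_nf; lia)

theorem run_times_of_get {k k' : Stk} (hk : k ≠ k') (x : Alph ι k)
    (x' : Alph ι k') (n : ℕ) (a : ℕ → St ι) (B : ℕ)
    (h : ∀ i < n, ∀ l l', Run c (((a i).set k l).set k' l') (((a (i + 1)).set k l).set k' l') B)
    (h0 : (a 0).get k = List.replicate n x) (h0' : (a 0).get k' = [])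
    (hn : (a n).get k = List.replicate n x) (hn' : (a n).get k' = []) :
    Run (times k k' x x' c) (a 0) (a n) (n * (B + 4) + 2) := by
  have := run_times hk x x' n a B h h0 h0'
  rwa [← hn, St.set_get, ← hn', St.set_get] at this

end Rules

end ParamMDP

/-! ### Reading the input -/

namespace ParamMDP

open StackProg StackProg.Cmd

variable {ι : Type}

theorem loops_push {k k' : Stk} (hk : k ≠ k') {isEnd : Alph ι k → Bool} (h : Alph ι k → Alph ι k')
    (s : St ι) (L : List (Alph ι k)) (hL : ∀ x ∈ L, isEnd x = false) :
    Loops k isEnd (fun x => push k' (h x)) s L (s.set k' ((L.map h).reverse ++ s.get k'))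
      (2 * L.length) := by
  induction L generalizing s with
  | nil => simpa using loops_nil s
  | cons x L ih =>
    have h₁ := loops_single (k := k) (isEnd := isEnd) (f := fun x => push k' (h x)) (x := x)
      (s := s) (s' := s.set k' (h x :: s.get k')) (t := 1) (hL x (by simp)) (fun l => by
        have := run_push k' (h x) (s.set k l)
        rwa [St.get_set_of_ne _ hk.symm, St.set_comm _ hk] at this)
    have h₂ := h₁.append (ih (s.set k' (h x :: s.get k')) fun y hy => hL y (by simp [hy]))
    rw [St.get_set, St.set_set] at h₂
    have e : ((x :: L).map h).reverse ++ s.get k' = (L.map h).reverse ++ h x :: s.get k' := by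
      rw [List.map_cons, List.reverse_cons, List.append_assoc, List.singleton_append]
    rw [e]
    exact h₂.mono (by rw [List.length_cons]; lia)

theorem loops_skip {k : Stk} {isEnd : Alph ι k → Bool} (s : St ι) (L : List (Alph ι k))
    (hL : ∀ x ∈ L, isEnd x = false) : Loops k isEnd (fun _ => skip) s L s (2 * L.length) :=
  (loops_of_seq (fun _ => s) 1 L hL fun _ _ _ => run_skip _).mono (by lia)

theorem run_move {k k' : Stk} (hk : k ≠ k') (h : Alph ι k → Alph ι k') {s : St ι}
    {L : List (Alph ι k)} (hs : s.get k = L) :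
    Run (loop k (fun _ => false) fun x => push k' (h x)) s
      ((s.set k' ((L.map h).reverse ++ s.get k')).set k []) (2 * L.length + 1) :=
  (loops_push hk h s L (by simp)).run hs

/-- Whether an input symbol is the separator. -/
def isSep : Symbol → Bool
  | .sep => true
  | _ => false

theorem isSep_of_mem_unary {n : ℕ} : ∀ x ∈ unary n, isSep x = false := by
  simp +contextual [unary, isSep]

theorem isSep_bitSymbol (b : Bool) : isSep (bitSymbol b) = false := by
  cases b <;> rfl

theorem isSep_of_mem_binary {n : ℕ} : ∀ x ∈ binary n, isSep x = false := by
  intro x hx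
  obtain ⟨b, -, rfl⟩ := List.mem_map.1 hx
  exact isSep_bitSymbol b

theorem binary_eq_nil {n : ℕ} : binary n = [] ↔ n = 0 := by
  rw [binary, List.map_eq_nil_iff]
  constructor
  · intro h
    have := Computability.decode_encodeNat n
    rw [h] at this
    exact this.symm
  · rintro rfl
    rfl

/-- Skip the input up to the next separator. -/
def skipInp : Cmd (Alph ι) := loop .inp isSep fun _ => skip

theorem run_skipInp (s : St ι) (L r : List Symbol) (hL : ∀ x ∈ L, isSep x = false) :
    Run skipInp { s with inp := L ++ .sep :: r } { s with inp := r } (2 * L.length + 1) :=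
  (loops_skip (k := .inp) (isEnd := isSep) { s with inp := L ++ .sep :: r } L hL).run_exit
    (x := Symbol.sep) rfl rfl

/-- Read the rest of the unary index of a parameter, of which `x` symbols have been read before, and
emit the token of a transition that has a positive probability unless the parameter is of the kind
`b`. The first number bounds how many further symbols are counted. When it is used up, the
parameter is taken to be of the kind `none`, and the rest of its index is skipped. -/
def readIndex (τ : ι → ℕ → Option Bool) (b : Bool) : ℕ → ℕ → Cmd (Alph ι)
  | 0, _ => skipInp.seq (push .toks (Tok.edge fun _ => true))
  | K + 1, x => pop .inp skip fun (c : Symbol) => match c with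
    | .one => readIndex τ b K (x + 1)
    | _ => push .toks (Tok.edge fun j => τ j x != some b)

theorem run_readIndex {τ : ι → ℕ → Option Bool} (b : Bool) (K x y : ℕ)
    (hτ : ∀ j z, x + K ≤ z → τ j z = none) (s : St ι) (r : List Symbol) (T : List (Tok ι)) :
    Run (readIndex τ b K x) { s with inp := unary y ++ .sep :: r, toks := T }
      { s with inp := r, toks := .edge (fun j => τ j (x + y) != some b) :: T } (2 * y + 2) := by
  induction K generalizing x y with
  | zero =>
    have h := (run_skipInp { s with toks := T } (unary y) r isSep_of_mem_unary).seq
      (run_push .toks (Tok.edge fun _ => true : Tok ι) { s with toks := T, inp := r })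
    have : (fun j => τ j (x + y) != some b) = fun _ => true := by
      funext j
      simp [hτ j (x + y) (by lia)]
    rw [this]
    exact h.mono (by simp [unary])
  | succ K ih =>
    cases y with
    | zero =>
      exact (Run.pop_cons (k := .inp) (x := Symbol.sep) (l := r) rfl (run_push .toks _ _)).mono
        (by lia)
    | succ y =>
      have := ih (x + 1) y (fun j z hz => hτ j z (by lia))
      rw [show x + 1 + y = x + (y + 1) by lia] at this
      exact (Run.pop_cons (k := .inp) (x := Symbol.one) (l := unary y ++ .sep :: r) rfl this).mono
        (by lia)

/-- The token of a transition with a given label. -/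
def Label.tok {k : ℕ} (τ : ι → ℕ → Option Bool) (l : Label k) : Tok ι := .edge fun j => l.pos (τ j)

/-- Read a transition label. The first symbol of the numerator of a fraction tells whether the
fraction is positive. -/
def readLabel (τ : ι → ℕ → Option Bool) (K : ℕ) : Cmd (Alph ι) :=
  pop .inp skip fun (c : Symbol) => match c with
    | .const =>
      (pop .inp skip fun (c : Symbol) => match c with
        | .sep => push .toks (Tok.edge fun _ => false)
        | _ => skipInp.seq (push .toks (Tok.edge fun _ => true))).seq skipInp
    | .param => readIndex τ false K 0
    | _ => readIndex τ true K 0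

theorem run_readLabel {τ : ι → ℕ → Option Bool} {K : ℕ} (hτ : ∀ j z, K ≤ z → τ j z = none) {k : ℕ}
    (l : Label k) (s : St ι) (r : List Symbol) (T : List (Tok ι)) :
    Run (readLabel τ K) { s with inp := l.encode ++ r, toks := T }
      { s with inp := r, toks := l.tok τ :: T } (2 * l.encode.length + 6) := by
  cases l with
  | const a b =>
    have hin : (Label.const a b : Label k).encode ++ r =
        Symbol.const :: (binary a ++ .sep :: (binary b ++ .sep :: r)) := by
      simp [Label.encode]
    have hlen : (Label.const a b : Label k).encode.length =
        (binary a).length + (binary b).length + 3 := by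
      simp [Label.encode]; lia
    rw [hin, hlen]
    have hskip := fun T => run_skipInp { s with toks := T } (binary b) r isSep_of_mem_binary
    by_cases ha : a = 0
    · have hb := binary_eq_nil.2 ha
      have ht : (Label.const a b : Label k).tok τ = .edge fun _ => false := by
        simp [Label.tok, Label.pos, ha]
      rw [ht, hb]
      refine (Run.pop_cons (k := .inp) (x := Symbol.const) (l := .sep :: (binary b ++ .sep :: r))
        (t := 1 + 1 + (2 * (binary b).length + 1)) rfl ?_).mono (by simp; lia)
      exact Run.seq (Run.pop_cons (k := .inp) (x := Symbol.sep) (l := binary b ++ .sep :: r) rfl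
          (run_push .toks (Tok.edge fun _ => false : Tok ι)
            { s with inp := binary b ++ .sep :: r, toks := T })) (hskip _)
    · obtain ⟨c, L, hc⟩ := List.exists_cons_of_ne_nil (mt binary_eq_nil.1 ha)
      have ht : (Label.const a b : Label k).tok τ = .edge fun _ => true := by
        have h0 : (a != 0) = true := by simpa using ha
        simp only [Label.tok, Label.pos, h0]
      have hsep : ∀ x ∈ c :: L, isSep x = false := hc ▸ isSep_of_mem_binary
      rw [ht, hc]
      refine (Run.pop_cons (k := .inp) (x := Symbol.const)
        (l := (c :: L) ++ .sep :: (binary b ++ .sep :: r))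
        (t := 1 + (2 * L.length + 1 + 1) + (2 * (binary b).length + 1)) rfl ?_).mono
        (by simp; lia)
      refine Run.seq (Run.pop_cons (k := .inp) (x := c) (l := L ++ .sep :: (binary b ++ .sep :: r))
        rfl ?_) (hskip (.edge (fun _ => true) :: T))
      have h₁ := (run_skipInp { s with toks := T } L (binary b ++ .sep :: r)
        fun x hx => hsep x (by simp [hx])).seq (run_push .toks (Tok.edge fun _ => true : Tok ι) _)
      cases c <;> first | exact h₁ | exact absurd (hsep Symbol.sep (by simp)) (by simp [isSep])
  | param x =>
    have hin : (Label.param x : Label k).encode ++ r = Symbol.param :: (unary x ++ .sep :: r) := by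
      simp [Label.encode]
    have hlen : (Label.param x : Label k).encode.length = x.1 + 2 := by
      simp [Label.encode, unary]
    rw [hin, hlen]
    have h := run_readIndex false K 0 x (by simpa using hτ) s r T
    rw [zero_add] at h
    exact (Run.pop_cons (k := .inp) (x := Symbol.param) (l := unary x ++ .sep :: r) rfl h).mono
      (by lia)
  | coparam x =>
    have hin : (Label.coparam x : Label k).encode ++ r =
        Symbol.coparam :: (unary x ++ .sep :: r) := by
      simp [Label.encode]
    have hlen : (Label.coparam x : Label k).encode.length = x.1 + 2 := by
      simp [Label.encode, unary]
    rw [hin, hlen]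
    have h := run_readIndex true K 0 x (by simpa using hτ) s r T
    rw [zero_add] at h
    exact (Run.pop_cons (k := .inp) (x := Symbol.coparam) (l := unary x ++ .sep :: r) rfl h).mono
      (by lia)

/-- Reading a list of items, the number of which is given by a counter. -/
theorem run_times_read {k k' : Stk} (hk : k ≠ k') {x : Alph ι k} {x' : Alph ι k'}
    {c : Cmd (Alph ι)} {β : Type*} (enc : β → List Symbol) (tok : β → List (Tok ι)) {B N : ℕ}
    (ys : List β) {s : St ι} {r : List Symbol} {T : List (Tok ι)}
    (h : ∀ y ∈ ys, ∀ r T l l', (enc y ++ r).length ≤ N →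
      Run c (({ s with inp := enc y ++ r, toks := T }.set k l).set k' l')
        (({ s with inp := r, toks := (tok y).reverse ++ T }.set k l).set k' l') B)
    (hN : (ys.flatMap enc ++ r).length ≤ N)
    (h0 : ∀ i T, { s with inp := i, toks := T }.get k = List.replicate ys.length x)
    (h0' : ∀ i T, { s with inp := i, toks := T }.get k' = []) :
    Run (times k k' x x' c) { s with inp := ys.flatMap enc ++ r, toks := T }
      { s with inp := r, toks := (ys.flatMap tok).reverse ++ T } (ys.length * (B + 4) + 2) := by
  have := run_times hk x x' (c := c) ys.length (fun i => { s with
    inp := (ys.drop i).flatMap enc ++ r, toks := ((ys.take i).flatMap tok).reverse ++ T }) B ?_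
    (h0 _ _) (h0' _ _)
  · beta_reduce at this
    rw [← h0 ((ys.drop ys.length).flatMap enc ++ r)
        (((ys.take ys.length).flatMap tok).reverse ++ T), St.set_get,
      ← h0' ((ys.drop ys.length).flatMap enc ++ r)
        (((ys.take ys.length).flatMap tok).reverse ++ T), St.set_get] at this
    simpa using this
  · intro i hi l l'
    have hd : ys.drop i = ys[i] :: ys.drop (i + 1) := List.drop_eq_getElem_cons hi
    have ht : ys.take (i + 1) = ys.take i ++ [ys[i]] := (List.take_append_getElem hi).symm
    have hN' : (enc ys[i] ++ ((ys.drop (i + 1)).flatMap enc ++ r)).length ≤ N := by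
      refine le_trans ?_ hN
      conv_rhs => rw [← List.take_append_drop i ys, List.flatMap_append, hd, List.flatMap_cons]
      simp only [List.length_append]
      lia
    have := h ys[i] (List.getElem_mem hi) ((ys.drop (i + 1)).flatMap enc ++ r)
      (((ys.take i).flatMap tok).reverse ++ T) l l' hN'
    simpa only [hd, ht, List.flatMap_cons, List.flatMap_append, List.flatMap_nil, List.append_nil,
      List.reverse_append, List.append_assoc] using this

/-- The tokens of a row. -/
def rowToks {n k : ℕ} (τ : ι → ℕ → Option Bool) : Option (Fin n → Label k) → List (Tok ι)
  | none => []
  | some f => .row :: (List.finRange n).map fun s' => (f s').tok τ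

/-- Read a row. -/
def readRow (τ : ι → ℕ → Option Bool) (K : ℕ) : Cmd (Alph ι) :=
  pop .inp skip fun (c : Symbol) => match c with
    | .enabled => (push .toks Tok.row).seq (times .n₂ .d₂ () () (readLabel τ K))
    | _ => skip

theorem encodeRow_some {n k : ℕ} (f : Fin n → Label k) :
    encodeRow (some f) = .enabled :: (List.finRange n).flatMap fun s' => (f s').encode := by
  rw [encodeRow, List.ofFn_eq_map, List.flatMap_def]

theorem run_readRow {τ : ι → ℕ → Option Bool} {K : ℕ} (hτ : ∀ j z, K ≤ z → τ j z = none) {n k : ℕ}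
    (f : Option (Fin n → Label k)) (s : St ι) (r : List Symbol) (T : List (Tok ι)) {N : ℕ}
    (hN : (encodeRow f ++ r).length ≤ N) (hn : s.n₂ = List.replicate n ()) (hd : s.d₂ = []) :
    Run (readRow τ K) { s with inp := encodeRow f ++ r, toks := T }
      { s with inp := r, toks := (rowToks τ f).reverse ++ T } (n * (2 * N + 10) + 4) := by
  cases f with
  | none =>
    exact (Run.pop_cons (k := .inp) (x := Symbol.disabled) (l := r) rfl (run_skip _)).mono (by lia)
  | some f =>
    rw [encodeRow_some] at hN ⊢
    have h := run_times_read (k := .n₂) (k' := .d₂) (x := ()) (x' := ()) (by decide)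
      (c := readLabel τ K) (fun s' => (f s').encode) (fun s' => [(f s').tok τ]) (B := 2 * N + 6)
      (N := N) (List.finRange n) (s := s) (r := r) (T := .row :: T)
      (fun y _ r T l l' hN => (run_readLabel hτ (f y) { s with n₂ := l, d₂ := l' } r T).mono (by
        simp only [List.length_append] at hN; lia))
      (by simp at hN ⊢; lia) (fun i T => by rw [List.length_finRange]; exact hn) (fun i T => hd)
    have h' := Run.pop_cons (k := .inp) (e := skip) (x := Symbol.enabled)
      (f := fun (c : Symbol) => match c with
        | .enabled => (push .toks Tok.row).seq (times .n₂ .d₂ () () (readLabel τ K))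
        | _ => skip)
      (s := { s with toks := T, inp :=
        .enabled :: ((List.finRange n).flatMap fun s' => (f s').encode) ++ r })
      (l := ((List.finRange n).flatMap fun s' => (f s').encode) ++ r) rfl
      ((run_push .toks (Tok.row : Tok ι) _).seq h)
    rw [List.length_finRange] at h'
    have e : (rowToks τ (some f)).reverse ++ T =
        ((List.finRange n).flatMap fun s' => [(f s').tok τ]).reverse ++ .row :: T := by
      rw [rowToks, List.map_eq_flatMap, List.reverse_cons, List.append_assoc, List.singleton_append]
    rw [e]
    exact h'.mono (by lia)

variable (I : SimpleInstance)

/-- The tokens of a state. -/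
def SimpleInstance.stateToks (τ : ι → ℕ → Option Bool) (s : Fin I.n) : List (Tok ι) :=
  .state :: (List.finRange I.m).flatMap fun a => rowToks τ (I.row s a)

/-- Read an instance. -/
def readInstance (τ : ι → ℕ → Option Bool) (K : ℕ) : Cmd (Alph ι) :=
  (loop .inp isSep fun _ => (push .n₁ ()).seq (push .n₂ ())).seq <|
  (loop .inp isSep fun _ => push .m ()).seq <|
  skipInp.seq <|
  (loop .inp isSep fun _ => push .ini ()).seq <|
  (loop .inp isSep fun (c : Symbol) => push .cells (match c with
    | .one => Cell.mk true false false
    | _ => Cell.mk false false false)).seq <|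
  times .n₁ .d₁ () () <| (push .toks Tok.state).seq <| times .m .dm () () <| readRow τ K

/-- The stacks before reading the transitions. -/
def SimpleInstance.header : St ι where
  n₁ := List.replicate I.n ()
  n₂ := List.replicate I.n ()
  m := List.replicate I.m ()
  ini := List.replicate I.init ()
  cells := ((List.finRange I.n).map fun s => ⟨decide (s ∈ I.target), false, false⟩).reverse

/-- The tokens of an instance. -/
def SimpleInstance.toks (τ : ι → ℕ → Option Bool) : List (Tok ι) :=
  (List.finRange I.n).flatMap (I.stateToks τ)

theorem SimpleInstance.encode_eq : I.encode =
    unary I.n ++ .sep :: (unary I.m ++ .sep :: (unary I.k ++ .sep :: (unary I.init ++ .sep ::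
      (((List.finRange I.n).map fun s => bitSymbol (decide (s ∈ I.target))) ++ .sep ::
        (List.finRange I.n).flatMap fun s =>
          (List.finRange I.m).flatMap fun a => encodeRow (I.row s a))))) := by
  simp only [encode, List.ofFn_eq_map, List.flatMap_def]

theorem run_readHeader (s : St ι) (r : List Symbol) :
    Run (loop .inp isSep fun _ => (push .n₁ ()).seq (push .n₂ ()))
      { s with inp := unary I.n ++ .sep :: r, n₁ := [], n₂ := [] }
      { s with inp := r, n₁ := List.replicate I.n (), n₂ := List.replicate I.n () }
      (3 * I.n + 1) := by
  have h := loops_of_seq (k := .inp) (isEnd := isSep)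
    (f := fun _ => (push .n₁ ()).seq (push .n₂ ()))
    (fun i => { s with
      inp := unary I.n ++ .sep :: r, n₁ := List.replicate i (), n₂ := List.replicate i () })
    2 (unary I.n) isSep_of_mem_unary fun i hi l => (run_push .n₁ () _).seq (run_push .n₂ () _)
  have hl : List.length (α := Alph ι .inp) (unary I.n) = I.n := List.length_replicate
  rw [hl] at h
  exact (h.run_exit (x := Symbol.sep) (l := r) rfl rfl).mono (by lia)

/-- Reading a part of the input, up to the next separator, symbol by symbol. -/
theorem run_readPart {k : Stk} (hk : Stk.inp ≠ k) (h : Symbol → Alph ι k) (s : St ι)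
    (L r : List Symbol) (hL : ∀ x ∈ L, isSep x = false) (hs : s.inp = L ++ .sep :: r) :
    Run (loop .inp isSep fun x => push k (h x)) s
      ((s.set k ((L.map h).reverse ++ s.get k)).set .inp r) (2 * L.length + 1) :=
  (loops_push (k := .inp) hk h s L hL).run_exit (x := Symbol.sep) rfl hs

theorem run_readInstance {τ : ι → ℕ → Option Bool} {K : ℕ} (hτ : ∀ j z, K ≤ z → τ j z = none)
    {N : ℕ} (hN : I.encode.length ≤ N) :
    Run (readInstance τ K) { inp := I.encode } { I.header with toks := (I.toks τ).reverse }
      (I.n * (I.m * (I.n * (2 * N + 10) + 8) + 7) + 12 * N + 12) := by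
  have hlen := hN
  rw [I.encode_eq] at hN ⊢
  simp only [List.length_append, List.length_cons] at hN
  set body := (List.finRange I.n).flatMap fun s =>
    (List.finRange I.m).flatMap fun a => encodeRow (I.row s a) with hbody
  set tg := (List.finRange I.n).map fun s => bitSymbol (decide (s ∈ I.target)) with htg
  have hu : ∀ n, (unary n).length = n := by simp [unary]
  simp only [hu] at hN
  have htgl : tg.length = I.n := by simp [htg]
  set i₄ := tg ++ .sep :: body with hi₄
  set i₃ := unary I.init ++ .sep :: i₄ with hi₃
  set i₂ := unary I.k ++ .sep :: i₃ with hi₂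
  set i₁ := unary I.m ++ .sep :: i₂ with hi₁
  have h₁ := run_readHeader I ({} : St ι) i₁
  have h₂ := run_readPart (k := .m) (by decide) (fun _ => ())
    ({ inp := i₁, n₁ := List.replicate I.n (), n₂ := List.replicate I.n () } : St ι) (unary I.m) i₂
    isSep_of_mem_unary rfl
  have h₃ := run_skipInp
    ({ n₁ := List.replicate I.n (), n₂ := List.replicate I.n (),
       m := List.replicate I.m () } : St ι)
    (unary I.k) i₃ isSep_of_mem_unary
  have h₄ := run_readPart (k := .ini) (by decide) (fun _ => ())
    ({ inp := i₃, n₁ := List.replicate I.n (), n₂ := List.replicate I.n (),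
       m := List.replicate I.m () } : St ι) (unary I.init) i₄
    isSep_of_mem_unary rfl
  have h₅ := run_readPart (k := .cells) (by decide) (fun (c : Symbol) => match c with
    | .one => Cell.mk true false false
    | _ => Cell.mk false false false)
    ({ inp := i₄, n₁ := List.replicate I.n (), n₂ := List.replicate I.n (),
       m := List.replicate I.m (), ini := List.replicate I.init () } : St ι) tg body
    (by simp [htg, isSep_bitSymbol]) rfl
  have hcells : (tg.map (fun (c : Symbol) => match c with
      | .one => Cell.mk true false false
      | _ => Cell.mk false false false)).reverse ++ [] =
      ((List.finRange I.n).map fun s => ⟨decide (s ∈ I.target), false, false⟩).reverse := by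
    rw [List.append_nil, htg, List.map_map]
    refine congrArg List.reverse ?_
    refine List.map_congr_left fun s _ => ?_
    by_cases hs : s ∈ I.target <;> simp [bitSymbol, hs]
  have h₆ := run_times_read (k := .n₁) (k' := .d₁) (x := ()) (x' := ()) (by decide)
    (c := (push .toks Tok.state).seq <| times .m .dm () () <| readRow τ K)
    (fun s => (List.finRange I.m).flatMap fun a => encodeRow (I.row s a)) (I.stateToks τ)
    (B := I.m * (I.n * (2 * N + 10) + 8) + 3) (N := N) (List.finRange I.n)
    (s := I.header) (r := []) (T := [])
    (fun y _ r T l l' hN => by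
      have h := run_times_read (k := .m) (k' := .dm) (x := ()) (x' := ()) (by decide)
        (c := readRow τ K) (fun a => encodeRow (I.row y a)) (fun a => rowToks τ (I.row y a))
        (B := I.n * (2 * N + 10) + 4) (N := N) (List.finRange I.m)
        (s := { I.header with n₁ := l, d₁ := l' }) (r := r) (T := .state :: T)
        (fun a _ r T l₂ l₂' hN => run_readRow hτ (I.row y a)
          { I.header with n₁ := l, d₁ := l', m := l₂, dm := l₂' } r T hN rfl rfl)
        hN (fun _ _ => by rw [List.length_finRange]; rfl) (fun _ _ => rfl)
      have h' := Run.seq (run_push .toks (Tok.state : Tok ι) { I.header with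
        inp := (List.finRange I.m).flatMap (fun a => encodeRow (I.row y a)) ++ r, n₁ := l,
        d₁ := l', toks := T }) h
      rw [List.length_finRange] at h'
      have e : (I.stateToks τ y).reverse ++ T =
          ((List.finRange I.m).flatMap fun a => rowToks τ (I.row y a)).reverse ++ .state :: T := by
        rw [SimpleInstance.stateToks, List.reverse_cons, List.append_assoc, List.singleton_append]
      rw [e]
      exact h'.mono (by lia))
    (by rw [List.append_nil]; lia) (fun _ _ => by rw [List.length_finRange]; rfl) (fun _ _ => rfl)
  rw [List.length_finRange, List.append_nil, List.append_nil] at h₆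
  have hm : ∀ n, (List.map (fun _ => ()) (unary n)).reverse ++ [] = List.replicate n () := by
    simp [unary]
  have g₂ : Run _ _
      ({ inp := i₂, n₁ := List.replicate I.n (), n₂ := List.replicate I.n (),
         m := List.replicate I.m () } : St ι) _ := hm I.m ▸ h₂
  have g₄ : Run _ _
      ({ inp := i₄, n₁ := List.replicate I.n (), n₂ := List.replicate I.n (),
         m := List.replicate I.m (), ini := List.replicate I.init () } : St ι) _ := hm I.init ▸ h₄
  have g₅ : Run _ _ { (I.header : St ι) with inp := body } _ := hcells ▸ h₅
  have := h₁.seq (g₂.seq (h₃.seq (g₄.seq (g₅.seq h₆))))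
  rw [hu, hu, hu, htgl] at this
  exact this.mono (by lia)

end ParamMDP

/-! ### The fixed-point iteration on stacks -/

namespace ParamMDP

open StackProg StackProg.Cmd

variable {ι : Type}

theorem run_move_cells' (h : Cell → Cell) (s : St ι) (l : List Cell) (C : List Cell) :
    Run (loop .cells' (fun _ => false) fun (x : Cell) => push .cells (h x))
      { s with cells' := l, cells := C }
      { s with cells' := [], cells := (l.map h).reverse ++ C } (2 * l.length + 1) :=
  run_move (k := .cells') (k' := .cells) (by decide) h rfl

theorem run_move_cells (h : Cell → Cell) (s : St ι) (l : List Cell) (C : List Cell) :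
    Run (loop .cells (fun _ => false) fun (x : Cell) => push .cells' (h x))
      { s with cells := l, cells' := C }
      { s with cells := [], cells' := (l.map h).reverse ++ C } (2 * l.length + 1) :=
  run_move (k := .cells) (k' := .cells') (by decide) h rfl

/-- The approximation of the greatest fixed point in a cell. -/
def Cell.nu (φ : Qualitative) (x : Cell) : Bool := if φ.outerGreatest then x.outer else x.inner

/-- The approximation of the least fixed point in a cell. -/
def Cell.mu (φ : Qualitative) (x : Cell) : Bool := if φ.outerGreatest then x.inner else x.outer

/-- Process a token. The stack `row` holds the conjunction and the disjunction over the successors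
read so far in the current row, and `acc` tells whether a suitable action has been read. Tokens are
processed in reverse reading order, so the token `row` ends a row and `state` ends a state. -/
def processTok (j : ι) (φ : Qualitative) (tok : Tok ι) : Cmd (Alph ι) :=
  (push .toks' tok).seq <| match tok with
    | .edge b => pop .cells skip fun (x : Cell) => (push .cells' x).seq <|
        pop .row skip fun (r : Bool × Bool) =>
          push .row (r.1 && (!b j || x.nu φ), r.2 || (b j && x.mu φ))
    | .row => pop .row skip fun (r : Bool × Bool) => (push .row (true, false)).seq <|
        pop .acc skip fun (c : Bool) => (push .acc (c || φ.suitable r.1 r.2)).seq <|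
          loop .cells' (fun _ => false) fun (x : Cell) => push .cells x
    | .state => pop .acc skip fun (c : Bool) => (push .acc false).seq (push .new c)

/-- Whether a row is suitable. -/
def rowSuitable {n k : ℕ} (τ : ℕ → Option Bool) (φ : Qualitative) (v : Fin n → Cell) :
    Option (Fin n → Label k) → Bool
  | none => false
  | some f => φ.suitable ((List.finRange n).all fun s' => !(f s').pos τ || (v s').nu φ)
      ((List.finRange n).any fun s' => (f s').pos τ && (v s').mu φ)

variable (τ : ι → ℕ → Option Bool) (j : ι) (φ : Qualitative)

theorem loops_edges {n k : ℕ} (v : Fin n → Cell) (f : Fin n → Label k) (ys : List (Fin n))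
    (s : St ι) (T : List (Tok ι)) (W : List Cell) (p q : Bool) :
    Loops .toks (fun _ => false) (processTok j φ)
      { s with toks' := T, cells := ys.reverse.map v, cells' := W, row := [(p, q)] }
      (ys.map fun s' => (f s').tok τ).reverse
      { s with
        toks' := (ys.map fun s' => (f s').tok τ) ++ T
        cells := []
        cells' := ys.map v ++ W
        row := [(p && ys.all fun s' => !(f s').pos (τ j) || (v s').nu φ,
          q || ys.any fun s' => (f s').pos (τ j) && (v s').mu φ)] } (6 * ys.length) := by
  induction ys using List.reverseRecOn generalizing T W p q with
  | nil =>
    exact (loops_nil _).congr rfl rfl (by simp) le_rfl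
  | append_singleton ys y ih =>
    have h₁ := loops_single (k := .toks) (isEnd := fun _ => false) (f := processTok j φ)
      (x := (f y).tok τ) (t := 5)
      (s := { s with
        toks' := T, cells := v y :: ys.reverse.map v, cells' := W, row := [(p, q)] })
      (s' := { s with
        toks' := (f y).tok τ :: T
        cells := ys.reverse.map v
        cells' := v y :: W
        row := [(p && (!(f y).pos (τ j) || (v y).nu φ), q || (f y).pos (τ j) && (v y).mu φ)] })
      rfl fun l => by
        refine Run.seq (t := 1) (t' := 4) (run_push .toks' ((f y).tok τ) _) ?_
        refine Run.pop_cons (k := .cells) (x := v y) (l := ys.reverse.map v) (t := 3) rfl ?_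
        refine Run.seq (t := 1) (t' := 2) (run_push .cells' (v y) _) ?_
        refine Run.pop_cons (k := .row) (x := (p, q)) (l := []) (t := 1) rfl ?_
        exact run_push .row _ _
    have h₂ := h₁.append (ih ((f y).tok τ :: T) (v y :: W) _ _)
    refine h₂.congr (by simp) (show (_ : List (Tok ι)) = _ from ?_)
      (by simp [Bool.and_assoc, Bool.or_assoc, Bool.and_comm, Bool.or_comm]) (by simp; lia)
    simp
    rfl

theorem loops_row {n k : ℕ} (v : Fin n → Cell) (f : Option (Fin n → Label k))
    (s : St ι) (T : List (Tok ι)) (c : Bool) :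
    Loops .toks (fun _ => false) (processTok j φ)
      { s with
        toks' := T, cells := (List.finRange n).reverse.map v, cells' := [], row := [(true, false)]
        acc := [c] }
      (rowToks τ f).reverse
      { s with
        toks' := rowToks τ f ++ T, cells := (List.finRange n).reverse.map v, cells' := []
        row := [(true, false)], acc := [rowSuitable (τ j) φ v f || c] } (8 * n + 8) := by
  cases f with
  | none =>
    exact (loops_nil _).mono (Nat.zero_le _)
  | some f =>
    have h₁ := loops_edges τ j φ v f (List.finRange n) { s with acc := [c] } T [] true false
    rw [Bool.true_and, Bool.false_or, List.append_nil] at h₁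
    set a := (List.finRange n).all fun s' => !(f s').pos (τ j) || (v s').nu φ with ha
    set e := (List.finRange n).any fun s' => (f s').pos (τ j) && (v s').mu φ with he
    set T' := ((List.finRange n).map fun s' => (f s').tok τ) ++ T with hT'
    have h₂ := loops_single (k := .toks) (isEnd := fun _ => false) (f := processTok j φ)
      (x := .row) (t := 2 * n + 6)
      (s := { s with
        toks' := T', cells := [], cells' := (List.finRange n).map v, row := [(a, e)], acc := [c] })
      (s' := { s with
        toks' := .row :: T', cells := (List.finRange n).reverse.map v, cells' := []
        row := [(true, false)], acc := [c || φ.suitable a e] })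
      rfl fun l => by
        refine Run.mono (t := 1 + (1 + (1 + (1 + (1 + (2 * n + 1)))))) ?_ (by lia)
        refine Run.seq (run_push .toks' .row _) ?_
        refine Run.pop_cons (k := .row) (x := (a, e)) (l := []) rfl ?_
        refine Run.seq (run_push .row (true, false) _) ?_
        refine Run.pop_cons (k := .acc) (x := c) (l := []) rfl ?_
        refine Run.seq (run_push .acc _ _) ?_
        have h := run_move_cells' id { s with
          toks := l, toks' := .row :: T', row := [(true, false)], acc := [c || φ.suitable a e] }
          ((List.finRange n).map v) []
        rw [List.length_map, List.length_finRange, List.map_id, List.append_nil,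
          ← List.map_reverse] at h
        exact h
    have h₃ := (h₁.append h₂).mono (t' := 8 * n + 8) (by rw [List.length_finRange]; lia)
    rw [rowToks, List.reverse_cons, rowSuitable, Bool.or_comm]
    exact h₃

theorem loops_rows {n k : ℕ} (v : Fin n → Cell) (ys : List (Option (Fin n → Label k)))
    (s : St ι) (T : List (Tok ι)) (c : Bool) :
    Loops .toks (fun _ => false) (processTok j φ)
      { s with
        toks' := T, cells := (List.finRange n).reverse.map v, cells' := [], row := [(true, false)]
        acc := [c] }
      (ys.flatMap (rowToks τ)).reverse
      { s with
        toks' := ys.flatMap (rowToks τ) ++ T, cells := (List.finRange n).reverse.map v, cells' := []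
        row := [(true, false)], acc := [ys.any (rowSuitable (τ j) φ v) || c] }
      (ys.length * (8 * n + 8)) := by
  induction ys with
  | nil => exact (loops_nil _).mono (Nat.zero_le _)
  | cons y ys ih =>
    have h := (ih.append (loops_row τ j φ v y s _ _)).mono
      (t' := (y :: ys).length * (8 * n + 8)) (by rw [List.length_cons]; lia)
    rw [List.flatMap_cons, List.reverse_append, List.append_assoc, List.any_cons, Bool.or_assoc]
    exact h

variable (I : SimpleInstance)

/-- Whether a state has a suitable action. -/
def SimpleInstance.hasSuitable (v : Fin I.n → Cell) (s : Fin I.n) : Bool :=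
  ((List.finRange I.m).map (I.row s)).any (rowSuitable (τ j) φ v)

theorem loops_states (v : Fin I.n → Cell) (ys : List (Fin I.n)) (s : St ι) (T : List (Tok ι))
    (E : List Bool) :
    Loops .toks (fun _ => false) (processTok j φ)
      { s with
        toks' := T, cells := (List.finRange I.n).reverse.map v, cells' := []
        row := [(true, false)], acc := [false], new := E }
      (ys.flatMap (I.stateToks τ)).reverse
      { s with
        toks' := ys.flatMap (I.stateToks τ) ++ T, cells := (List.finRange I.n).reverse.map v
        cells' := [], row := [(true, false)], acc := [false]
        new := ys.map (I.hasSuitable τ j φ v) ++ E }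
      (ys.length * (I.m * (8 * I.n + 8) + 5)) := by
  induction ys with
  | nil => exact (loops_nil _).mono (Nat.zero_le _)
  | cons y ys ih =>
    have h₁ := loops_rows τ j φ v ((List.finRange I.m).map (I.row y))
      { s with new := ys.map (I.hasSuitable τ j φ v) ++ E } (ys.flatMap (I.stateToks τ) ++ T) false
    rw [List.flatMap_map, Bool.or_false, List.length_map, List.length_finRange] at h₁
    set T' := (List.finRange I.m).flatMap (fun a => rowToks τ (I.row y a)) ++
      (ys.flatMap (I.stateToks τ) ++ T) with hT'
    have h₂ := loops_single (k := .toks) (isEnd := fun _ => false) (f := processTok j φ)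
      (x := .state) (t := 4)
      (s := { s with
        toks' := T', cells := (List.finRange I.n).reverse.map v, cells' := []
        row := [(true, false)], acc := [I.hasSuitable τ j φ v y]
        new := ys.map (I.hasSuitable τ j φ v) ++ E })
      (s' := { s with
        toks' := .state :: T', cells := (List.finRange I.n).reverse.map v, cells' := []
        row := [(true, false)], acc := [false]
        new := I.hasSuitable τ j φ v y :: (ys.map (I.hasSuitable τ j φ v) ++ E) })
      rfl fun l => by
        refine Run.seq (t := 1) (t' := 3) (run_push .toks' .state _) ?_
        refine Run.pop_cons (k := .acc) (x := I.hasSuitable τ j φ v y) (l := []) (t := 2) rfl ?_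
        exact Run.seq (t := 1) (t' := 1) (run_push .acc false _) (run_push .new _ _)
    exact (ih.append (h₁.append h₂)).congr rfl
      (show (_ : List (Tok ι)) = _ by simp [SimpleInstance.stateToks]; rfl)
      (by simp [SimpleInstance.stateToks, hT']) (by rw [List.length_cons]; lia)

end ParamMDP

/-! ### The decision procedure -/

namespace ParamMDP

open StackProg StackProg.Cmd

variable {ι : Type}

/-- One step of the fixed-point iteration. -/
def stepCells (j : ι) (φ : Qualitative) : Cmd (Alph ι) :=
  (push .row (true, false)).seq <| (push .acc false).seq <|
  (loop .toks (fun _ => false) (processTok j φ)).seq <|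
  (pop .row skip fun _ => skip).seq <| (pop .acc skip fun _ => skip).seq <|
  (loop .toks' (fun _ => false) fun (x : Tok ι) => push .toks x).seq <|
  (loop .cells (fun _ => false) fun (x : Cell) => push .cells' x).seq <|
  loop .cells' (fun _ => false) fun (x : Cell) => pop .new skip fun (e : Bool) =>
    push .cells { x with inner := φ.combine x.target e }

/-- Apply a function to the data of every state. -/
def mapCells (h : Cell → Cell) : Cmd (Alph ι) :=
  (loop .cells (fun _ => false) fun (x : Cell) => push .cells' (h x)).seq <|
  loop .cells' (fun _ => false) fun (x : Cell) => push .cells x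

/-- The nested fixed-point iteration. -/
def solveCells (j : ι) (φ : Qualitative) : Cmd (Alph ι) :=
  (mapCells fun x => { x with outer := φ.outerGreatest }).seq <|
  times .n₁ .d₁ () () <|
    (mapCells fun x => { x with inner := !φ.outerGreatest }).seq <|
    (times .n₂ .d₂ () () (stepCells j φ)).seq <|
    mapCells fun x => { x with outer := x.inner }

/-- Push a symbol to `ans` if the initial state belongs to the outer fixed point, or, if `neg` is
true, if it does not. -/
def readAnswer (neg : Bool) : Cmd (Alph ι) :=
  (loop .cells (fun _ => false) fun (x : Cell) => push .cells' x).seq <|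
  (times .ini .dini () () <| pop .cells' skip fun (x : Cell) => push .cells x).seq <|
  (pop .cells' skip fun (x : Cell) => (push .cells' x).seq <|
    if xor neg x.outer then push .ans () else skip).seq <|
  loop .cells' (fun _ => false) fun (x : Cell) => push .cells x

/-- Answer the question for a choice of kinds. -/
def checkKind (Q : Quantifier) (φ : Qualitative) (j : ι) : Cmd (Alph ι) :=
  match Q with
  | .ex => (solveCells j φ).seq (readAnswer false)
  | .all => (solveCells j φ.dual).seq (readAnswer true)

/-- Answer the question for a list of choices of kinds. -/
def checkKinds (Q : Quantifier) (φ : Qualitative) : List ι → Cmd (Alph ι)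
  | [] => skip
  | j :: js => (checkKind Q φ j).seq (checkKinds Q φ js)

/-- Output whether the stack `ans` is non-empty, and clear all other stacks. -/
def output : Cmd (Alph ι) :=
  (pop .ans (push .out false) fun _ => push .out true).seq <|
  clear [.inp, .n₁, .d₁, .n₂, .d₂, .m, .dm, .ini, .dini, .toks, .toks', .cells, .cells', .row, .acc,
    .new, .ans]

variable (I : SimpleInstance) (τ : ι → ℕ → Option Bool) (j : ι) (φ : Qualitative)

/-- The data of a state, for given approximations of the outer and the inner fixed point. -/
def SimpleInstance.cell (o i : Fin I.n → Bool) (s : Fin I.n) : Cell :=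
  ⟨decide (s ∈ I.target), o s, i s⟩

/-- The stacks between two steps of the fixed-point iteration, where `s` gives the contents of the
stacks that are not used by the step. -/
def SimpleInstance.work (s : St ι) (o i : Fin I.n → Bool) : St ι :=
  { s with
    toks := (I.toks τ).reverse, toks' := []
    cells := (List.finRange I.n).reverse.map (I.cell o i), cells' := []
    row := [], acc := [], new := [] }

/-- One step of the fixed-point iteration for an instance. -/
noncomputable def SimpleInstance.step (τ : ℕ → Option Bool) :
    (Fin I.n → Bool) → (Fin I.n → Bool) → Fin I.n → Bool :=
  φ.body (fun s a => ∃ f, I.row s a = some f)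
    (fun s a s' => ∃ f, I.row s a = some f ∧ (f s').pos τ = true) (fun s => decide (s ∈ I.target))

theorem SimpleInstance.combine_hasSuitable (o i : Fin I.n → Bool) (s : Fin I.n) :
    φ.combine (decide (s ∈ I.target)) (I.hasSuitable τ j φ (I.cell o i) s) =
      I.step φ (τ j) o i s := by
  have key : ∀ ν μ : Fin I.n → Bool, (∀ s, (I.cell o i s).nu φ = ν s) →
      (∀ s, (I.cell o i s).mu φ = μ s) →
      φ.combine (decide (s ∈ I.target)) (I.hasSuitable τ j φ (I.cell o i) s) =
      φ.pre (fun s a => ∃ f, I.row s a = some f)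
        (fun s a s' => ∃ f, I.row s a = some f ∧ (f s').pos (τ j) = true)
        (fun s => decide (s ∈ I.target)) ν μ s := by
    intro ν μ hν hμ
    refine Qualitative.combine_eq_pre (t := fun s => decide (s ∈ I.target)) ?_
    rw [hasSuitable, List.any_map, List.any_eq_true]
    refine exists_congr fun a => ?_
    rw [Function.comp_apply]
    cases hf : I.row s a with
    | none => simp [rowSuitable]
    | some f =>
      simp only [List.mem_finRange, true_and, Option.some.injEq, exists_eq', exists_eq_left',
        rowSuitable, hν, hμ]
      refine ⟨fun h => ⟨_, _, ?_, ?_, h⟩, ?_⟩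
      · simp [imp_iff_not_or]
      · simp
      · rintro ⟨p, q, hp, hq, h⟩
        convert h using 2
        · rw [Bool.eq_iff_iff, hp]
          simp [imp_iff_not_or]
        · rw [Bool.eq_iff_iff, hq]
          simp
  unfold SimpleInstance.step Qualitative.body
  split <;> rename_i h <;> exact key _ _ (fun s => by simp [Cell.nu, cell, h])
    (fun s => by simp [Cell.mu, cell, h])

theorem SimpleInstance.length_toks_le : (I.toks τ).length ≤ I.n * (I.m * (I.n + 1) + 1) := by
  have h₁ : ∀ s a, (rowToks τ (I.row s a)).length ≤ I.n + 1 := by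
    intro s a
    cases I.row s a <;> simp [rowToks]
  have h₂ : ∀ s, (I.stateToks τ s).length ≤ I.m * (I.n + 1) + 1 := by
    intro s
    rw [stateToks, List.length_cons, List.length_flatMap]
    have := List.sum_le_card_nsmul
      ((List.finRange I.m).map fun a => (rowToks τ (I.row s a)).length) (I.n + 1) (by simp [h₁])
    simpa using this
  rw [toks, List.length_flatMap]
  have := List.sum_le_card_nsmul
    ((List.finRange I.n).map fun s => (I.stateToks τ s).length) (I.m * (I.n + 1) + 1) (by simp [h₂])
  simpa using this

theorem loops_update (s : St ι) (v : Fin I.n → Cell) (e : Fin I.n → Bool) (ys : List (Fin I.n))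
    (C : List Cell) :
    Loops .cells' (fun _ => false) (fun (x : Cell) => pop .new skip fun (e : Bool) =>
        push .cells { x with inner := φ.combine x.target e })
      { s with cells := C, new := ys.map e } (ys.map v)
      { s with
        cells := (ys.map fun s => { v s with inner := φ.combine (v s).target (e s) }).reverse ++ C
        new := [] } (3 * ys.length) := by
  induction ys generalizing C with
  | nil => exact loops_nil _
  | cons y ys ih =>
    have h₁ := loops_single (k := .cells') (isEnd := fun _ => false)
      (f := fun (x : Cell) => pop .new skip fun (e : Bool) =>
        push .cells { x with inner := φ.combine x.target e }) (x := v y) (t := 2)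
      (s := { s with cells := C, new := e y :: ys.map e })
      (s' := { s with
        cells := { v y with inner := φ.combine (v y).target (e y) } :: C, new := ys.map e })
      rfl fun l => Run.pop_cons (k := .new) (x := e y) (l := ys.map e) (t := 1) rfl
        (run_push .cells _ _)
    exact (h₁.append (ih _)).congr rfl rfl (by simp) (by rw [List.length_cons]; lia)

theorem run_stepCells (s : St ι) (o i : Fin I.n → Bool) :
    Run (stepCells j φ) (I.work τ s o i) (I.work τ s o (I.step φ (τ j) o i))
      (I.n * (I.m * (10 * I.n + 10) + 12) + 13) := by
  set v := I.cell o i with hv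
  set e := I.hasSuitable τ j φ v with he
  set L := (List.finRange I.n).reverse.map v with hL
  have h₁ := (loops_states τ j φ I v (List.finRange I.n) { s with toks := (I.toks τ).reverse }
    [] []).run rfl
  rw [List.length_finRange] at h₁
  have h₂ : Run (loop .toks' (fun _ => false) fun (x : Tok ι) => push .toks x)
      { s with toks := [], toks' := I.toks τ, cells := L, cells' := [], row := [], acc := [],
               new := (List.finRange I.n).map e }
      { s with toks := (I.toks τ).reverse, toks' := [], cells := L, cells' := [], row := [],
               acc := [], new := (List.finRange I.n).map e }
      (2 * (I.toks τ).length + 1) := by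
    have h := run_move (k := .toks') (k' := .toks) (by decide) id (s :=
      { s with toks := [], toks' := I.toks τ, cells := L, cells' := [], row := [], acc := [],
               new := (List.finRange I.n).map e }) rfl
    have e : (List.map id (I.toks τ)).reverse ++ [] = (I.toks τ).reverse := by simp
    exact e ▸ h
  have h₃ := run_move_cells id { s with
    toks := (I.toks τ).reverse, toks' := [], row := [], acc := [],
    new := (List.finRange I.n).map e } L []
  have eL : (L.map id).reverse ++ [] = (List.finRange I.n).map v := by simp [hL]
  rw [eL] at h₃
  have h₄ := (loops_update I φ { s with
    toks := (I.toks τ).reverse, toks' := [], row := [], acc := [],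
    cells' := (List.finRange I.n).map v } v e (List.finRange I.n) []).run rfl
  have e₄ : ((List.finRange I.n).map fun s =>
      { v s with inner := φ.combine (v s).target (e s) }).reverse ++ [] =
      (List.finRange I.n).reverse.map (I.cell o (I.step φ (τ j) o i)) := by
    rw [List.append_nil, ← List.map_reverse]
    refine List.map_congr_left fun s _ => ?_
    rw [SimpleInstance.cell, ← I.combine_hasSuitable τ]
    rfl
  rw [e₄, List.length_finRange] at h₄
  have hl : L.length = I.n := by simp [hL]
  rw [hl] at h₃
  have ht := I.length_toks_le τ
  refine Run.mono (t := 1 + (1 + (I.n * (I.m * (8 * I.n + 8) + 5) + 1 + (2 + (2 +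
    (2 * (I.toks τ).length + 1 + (2 * I.n + 1 + (3 * I.n + 1)))))))) ?_ (by lia)
  refine Run.seq (run_push .row (true, false) _) ?_
  refine Run.seq (run_push .acc false _) ?_
  refine Run.seq h₁ ?_
  refine Run.seq (Run.pop_cons (k := .row) (x := (true, false)) (l := []) (t := 1) rfl
    (run_skip _)) ?_
  refine Run.seq (Run.pop_cons (k := .acc) (x := false) (l := []) (t := 1) rfl (run_skip _)) ?_
  have e₁ : (List.finRange I.n).flatMap (I.stateToks τ) ++ [] = I.toks τ := by
    rw [List.append_nil]; rfl
  have e₂ : (List.finRange I.n).map e ++ [] = (List.finRange I.n).map e := List.append_nil _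
  rw [he] at e₂
  rw [e₁, e₂]
  exact h₂.seq (h₃.seq h₄)

theorem run_mapCells (h : Cell → Cell) (s : St ι) (o i o' i' : Fin I.n → Bool)
    (hh : ∀ s, h (I.cell o i s) = I.cell o' i' s) :
    Run (mapCells h) (I.work τ s o i) (I.work τ s o' i') (4 * I.n + 2) := by
  have h₁ := run_move_cells h { s with
    toks := (I.toks τ).reverse, toks' := [], row := [], acc := [], new := [] }
    ((List.finRange I.n).reverse.map (I.cell o i)) []
  have h₂ := run_move_cells' id { s with
    toks := (I.toks τ).reverse, toks' := [], row := [], acc := [], new := [] }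
    ((List.finRange I.n).map (I.cell o' i')) []
  have e : (((List.finRange I.n).reverse.map (I.cell o i)).map h).reverse ++ [] =
      (List.finRange I.n).map (I.cell o' i') := by simp [hh]
  rw [e, List.length_map, List.length_reverse, List.length_finRange] at h₁
  rw [List.map_id, List.append_nil, ← List.map_reverse, List.length_map, List.length_finRange] at h₂
  exact (h₁.seq h₂).mono (by lia)

theorem run_solveCells (s : St ι) (o i : Fin I.n → Bool) (h₁ : s.n₁ = List.replicate I.n ())
    (h₂ : s.n₂ = List.replicate I.n ()) (hd₁ : s.d₁ = []) (hd₂ : s.d₂ = []) :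
    ∃ i', Run (solveCells j φ) (I.work τ s o i)
      (I.work τ s (φ.solve (fun s a => ∃ f, I.row s a = some f)
        (fun s a s' => ∃ f, I.row s a = some f ∧ (f s').pos (τ j) = true)
        (fun s => decide (s ∈ I.target)) I.n) i')
      (I.n * (I.n * (I.n * (I.m * (10 * I.n + 10) + 12) + 17) + 8 * I.n + 10) + 4 * I.n + 4) := by
  have hin : ∀ s o, s.n₂ = List.replicate I.n () → s.d₂ = [] →
      Run (times .n₂ .d₂ () () (stepCells j φ)) (I.work τ s o fun _ => !φ.outerGreatest)
        (I.work τ s o ((I.step φ (τ j) o)^[I.n] fun _ => !φ.outerGreatest))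
        (I.n * (I.n * (I.m * (10 * I.n + 10) + 12) + 17) + 2) := by
    intro s o h hd
    have := run_times_of_get (k := .n₂) (k' := .d₂) (by decide) () () (c := stepCells j φ) I.n
      (fun n => I.work τ s o ((I.step φ (τ j) o)^[n] fun _ => !φ.outerGreatest))
      (I.n * (I.m * (10 * I.n + 10) + 12) + 13) (fun n _ l l' => by
        rw [Function.iterate_succ_apply']
        exact run_stepCells I τ j φ { s with n₂ := l, d₂ := l' } o _) h hd h hd
    exact this
  have hbody : ∀ s o i, s.n₂ = List.replicate I.n () → s.d₂ = [] →
      Run ((mapCells fun x => { x with inner := !φ.outerGreatest }).seq <|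
        (times .n₂ .d₂ () () (stepCells j φ)).seq <|
        mapCells fun x => { x with outer := x.inner }) (I.work τ s o i)
        (I.work τ s ((I.step φ (τ j) o)^[I.n] fun _ => !φ.outerGreatest)
          ((I.step φ (τ j) o)^[I.n] fun _ => !φ.outerGreatest))
        (I.n * (I.n * (I.m * (10 * I.n + 10) + 12) + 17) + 8 * I.n + 6) := by
    intro s o i h hd
    exact ((run_mapCells I τ _ s o i o (fun _ => !φ.outerGreatest) fun _ => rfl).seq
      ((hin s o h hd).seq (run_mapCells I τ _ s o _ _ _ fun _ => rfl))).mono (by lia)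
  -- the inner approximations after every round of the outer iteration
  let out : ℕ → Fin I.n → Bool := fun n =>
    (fun o => (I.step φ (τ j) o)^[I.n] fun _ => !φ.outerGreatest)^[n] fun _ => φ.outerGreatest
  let inn : ℕ → Fin I.n → Bool := fun n => match n with
    | 0 => i
    | n + 1 => out (n + 1)
  refine ⟨inn I.n, ?_⟩
  have h := run_times_of_get (k := .n₁) (k' := .d₁) (by decide) () () I.n
      (fun n => I.work τ s (out n) (inn n)) _ (fun n _ l l' => by
        have h := hbody { s with n₁ := l, d₁ := l' } (out n) (inn n) h₂ hd₂
        have e : inn (n + 1) = (I.step φ (τ j) (out n))^[I.n] fun _ => !φ.outerGreatest :=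
          Function.iterate_succ_apply' _ _ _
        have e' : out (n + 1) = (I.step φ (τ j) (out n))^[I.n] fun _ => !φ.outerGreatest :=
          Function.iterate_succ_apply' _ _ _
        rw [← e'] at h
        exact h) h₁ hd₁ h₁ hd₁
  exact ((run_mapCells I τ _ s o i (fun _ => φ.outerGreatest) i fun _ => rfl).seq h).mono (by lia)

theorem run_readAnswer (neg : Bool) (s : St ι) (o i : Fin I.n → Bool)
    (hi : s.ini = List.replicate I.init ()) (hd : s.dini = []) :
    Run (readAnswer neg) (I.work τ s o i)
      (I.work τ { s with ans := if xor neg (o I.init) then () :: s.ans else s.ans } o i)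
      (10 * I.n + 10) := by
  set v := I.cell o i with hv
  set L := (List.finRange I.n).map v with hL
  have hLl : L.length = I.n := by simp [hL]
  have hii : (I.init : ℕ) < L.length := by rw [hLl]; exact I.init.2
  have hLi : L[(I.init : ℕ)] = v I.init := by simp [hL]
  have hrev : (List.finRange I.n).reverse.map v = L.reverse := by simp [hL]
  set s₀ : St ι := { s with toks := (I.toks τ).reverse, toks' := [], row := [], acc := [],
                            new := [] } with hs₀
  have h₁ := run_move_cells id s₀ L.reverse []
  rw [List.map_id, List.reverse_reverse, List.append_nil, List.length_reverse, hLl] at h₁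
  have h₂ := run_times_of_get (k := .ini) (k' := .dini) (by decide) () ()
    (c := pop .cells' skip fun (x : Cell) => push .cells x) I.init
    (fun n => { s₀ with cells := (L.take n).reverse, cells' := L.drop n }) 2 (fun n hn l l' => by
      have hn' : n < L.length := hn.trans hii
      have hdr : L.drop n = L[n] :: L.drop (n + 1) := List.drop_eq_getElem_cons hn'
      have htk : (L.take (n + 1)).reverse = L[n] :: (L.take n).reverse := by
        rw [← List.take_append_getElem hn', List.reverse_append]; rfl
      rw [htk]
      exact Run.pop_cons (k := .cells') (x := L[n]) (l := L.drop (n + 1)) (t := 1) hdr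
        (run_push .cells _ _)) hi hd hi hd
  have hdr : L.drop I.init = v I.init :: L.drop (I.init + 1) := by
    rw [List.drop_eq_getElem_cons hii, hLi]
  have h₃ : Run (pop .cells' skip fun (x : Cell) => (push .cells' x).seq <|
      if xor neg x.outer then push .ans () else skip)
      { s₀ with cells := (L.take I.init).reverse, cells' := L.drop I.init }
      { s₀ with cells := (L.take I.init).reverse, cells' := L.drop I.init,
                ans := if xor neg (o I.init) then () :: s.ans else s.ans } 3 := by
    rw [hdr]
    refine Run.pop_cons (k := .cells') (x := v I.init) (l := L.drop (I.init + 1)) (t := 2) rfl ?_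
    refine Run.seq (t := 1) (t' := 1) (run_push .cells' (v I.init) _) ?_
    have ho : (v I.init).outer = o I.init := rfl
    rw [ho]
    cases xor neg (o I.init)
    · exact run_skip _
    · exact run_push .ans () _
  have h₄ := run_move_cells' id { s₀ with
    ans := if xor neg (o I.init) then () :: s.ans else s.ans } (L.drop I.init)
    (L.take I.init).reverse
  rw [List.map_id, ← List.reverse_append, List.take_append_drop, List.length_drop] at h₄
  have h := h₁.seq (h₂.seq (h₃.seq h₄))
  rw [← hrev] at h
  exact h.mono (by lia)

theorem exists_run_checkKind (Q : Quantifier) (s : St ι) (o i : Fin I.n → Bool)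
    (h₁ : s.n₁ = List.replicate I.n ()) (h₂ : s.n₂ = List.replicate I.n ()) (hd₁ : s.d₁ = [])
    (hd₂ : s.d₂ = []) (hi : s.ini = List.replicate I.init ()) (hd : s.dini = []) :
    ∃ o' i', Run (checkKind Q φ j) (I.work τ s o i)
      (I.work τ { s with ans := if I.answer Q φ (τ j) then () :: s.ans else s.ans } o' i')
      (I.n * (I.n * (I.n * (I.m * (10 * I.n + 10) + 12) + 17) + 8 * I.n + 10) + 14 * I.n + 14) := by
  cases Q with
  | ex =>
    obtain ⟨i', h⟩ := run_solveCells I τ j φ s o i h₁ h₂ hd₁ hd₂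
    have h' := h.seq (run_readAnswer I τ false s _ i' hi hd)
    rw [Bool.false_xor] at h'
    exact ⟨_, i', h'.mono (by lia)⟩
  | all =>
    obtain ⟨i', h⟩ := run_solveCells I τ j φ.dual s o i h₁ h₂ hd₁ hd₂
    have h' := h.seq (run_readAnswer I τ true s _ i' hi hd)
    rw [Bool.true_xor] at h'
    exact ⟨_, i', h'.mono (by lia)⟩

theorem exists_run_checkKinds (Q : Quantifier) (js : List ι) (s : St ι) (o i : Fin I.n → Bool)
    (h₁ : s.n₁ = List.replicate I.n ()) (h₂ : s.n₂ = List.replicate I.n ()) (hd₁ : s.d₁ = [])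
    (hd₂ : s.d₂ = []) (hi : s.ini = List.replicate I.init ()) (hd : s.dini = []) :
    ∃ o' i' A, (A = [] ↔ s.ans = [] ∧ ∀ j ∈ js, I.answer Q φ (τ j) = false) ∧
      A.length ≤ s.ans.length + js.length ∧
      Run (checkKinds Q φ js) (I.work τ s o i) (I.work τ { s with ans := A } o' i')
      (js.length * (I.n * (I.n * (I.n * (I.m * (10 * I.n + 10) + 12) + 17) + 8 * I.n + 10) +
        14 * I.n + 14) + 1) := by
  induction js generalizing s o i with
  | nil => exact ⟨o, i, s.ans, by simp, by simp, (run_skip _).mono (by lia)⟩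
  | cons j js ih =>
    obtain ⟨o₁, i₁, h⟩ := exists_run_checkKind I τ j φ Q s o i h₁ h₂ hd₁ hd₂ hi hd
    obtain ⟨o₂, i₂, A, hA, hl, h'⟩ := ih
      { s with ans := if I.answer Q φ (τ j) then () :: s.ans else s.ans } o₁ i₁ h₁ h₂ hd₁ hd₂ hi hd
    refine ⟨o₂, i₂, A, ?_, ?_, (h.seq h').mono (le_of_eq (by rw [List.length_cons]; ring))⟩
    · rw [hA, List.forall_mem_cons, ← and_assoc]
      refine and_congr_left fun _ => ?_
      cases I.answer Q φ (τ j) <;> simp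
    · refine hl.trans ?_
      cases I.answer Q φ (τ j)
      · simp
      · simp
        lia

end ParamMDP

namespace ParamMDP

open StackProg StackProg.Cmd

variable {ι : Type}

theorem PolyTimeDecidable.congr {α Γ : Type} {enc : α → List Γ} {L L' : α → Prop}
    (h : PolyTimeDecidable enc L) (hL : ∀ a, L' a ↔ L a) : PolyTimeDecidable enc L' := by
  rwa [show L' = L from funext fun a => propext (hL a)]

theorem run_clear {M : ℕ} (ks : List Stk) (s : St ι) (h : ∀ k, (s.get k).length ≤ M) :
    Run (clear ks) s (ks.foldl (fun s k => s.set k []) s) (ks.length * (2 * M + 2) + 1) := by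
  induction ks generalizing s with
  | nil => exact (run_skip s).mono (by lia)
  | cons k ks ih =>
    have h₁ := (loops_skip (k := k) (isEnd := fun _ => false) s (s.get k) (by simp)).run rfl
    have h₂ := ih (s.set k []) fun k' => by
      by_cases hk : k' = k
      · subst hk
        simp
      · rw [St.get_set_of_ne _ hk]
        exact h k'
    exact (h₁.seq h₂).mono (by rw [List.length_cons, Nat.add_mul]; have := h k; lia)

theorem run_output {M : ℕ} (s : St ι) (h : ∀ k, (s.get k).length ≤ M) (hM : 1 ≤ M)
    (hs : s.out = []) :
    Run output s { out := [!s.ans.isEmpty] } (34 * M + 37) := by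
  have h₁ : Run (pop .ans (push .out false) fun _ => push .out true) s
      { s with ans := s.ans.tail, out := [!s.ans.isEmpty] } 2 := by
    cases ha : s.ans with
    | nil =>
      have := Run.pop_nil (k := .ans) (f := fun _ => push .out true) ha (run_push .out false s)
      have e : s.set .out (false :: s.get .out) = { s with ans := [], out := [false] } := by
        rw [← ha, ← show false :: s.out = [false] by rw [hs]]
        rfl
      rw [e] at this
      exact this
    | cons x l =>
      have := Run.pop_cons (k := .ans) (e := push .out false) (f := fun _ => push .out true) ha
        (run_push .out true _)
      have e : (s.set .ans l).set .out (true :: (s.set .ans l).get .out) =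
          { s with ans := l, out := [true] } := by
        rw [← show true :: s.out = [true] by rw [hs]]
        rfl
      rw [e] at this
      exact this
  have h₂ := run_clear (M := M) [.inp, .n₁, .d₁, .n₂, .d₂, .m, .dm, .ini, .dini, .toks, .toks',
    .cells, .cells', .row, .acc, .new, .ans] { s with ans := s.ans.tail, out := [!s.ans.isEmpty] }
    fun k => by
      cases k
      case ans => exact List.length_tail.trans_le ((Nat.sub_le _ _).trans (h .ans))
      case out => exact hM
      case inp => exact h .inp
      case n₁ => exact h .n₁
      case d₁ => exact h .d₁
      case n₂ => exact h .n₂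
      case d₂ => exact h .d₂
      case m => exact h .m
      case dm => exact h .dm
      case ini => exact h .ini
      case dini => exact h .dini
      case toks => exact h .toks
      case toks' => exact h .toks'
      case cells => exact h .cells
      case cells' => exact h .cells'
      case row => exact h .row
      case acc => exact h .acc
      case new => exact h .new
  exact (h₁.seq h₂).mono (by simp; lia)

/-- For a fixed finite set of choices of kinds of the parameter values, the disjunction of the
answers is computable in polynomial time. -/
theorem polyTimeDecidable_exists_answer [Fintype ι] {K : ℕ} {τ : ι → ℕ → Option Bool}
    (hτ : ∀ j z, K ≤ z → τ j z = none) {α : Type} (inst : α → SimpleInstance) (Q : Quantifier)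
    (φ : Qualitative) :
    PolyTimeDecidable (fun a => (inst a).encode) fun a =>
      ∃ j, (inst a).answer Q φ (τ j) = true := by
  classical
  set c := Fintype.card ι with hc
  -- the time bounds for reading, solving and writing, with the numbers of states and of actions
  -- replaced by the length of the input
  refine polyTimeDecidable_of_cmd (Γ := Alph ι) _ _ .inp .out (Equiv.refl Symbol) (Equiv.refl Bool)
    ((readInstance τ K).seq ((checkKinds Q φ Finset.univ.toList).seq output))
    (.X * (.X * (.X * (2 * .X + 10) + 8) + 7) + 12 * .X + 12 +
      (c * (.X * (.X * (.X * (.X * (10 * .X + 10) + 12) + 17) + 8 * .X + 10) + 14 * .X + 14) + 1 +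
        (34 * (.X * (.X * (.X + 1) + 1) + .X + c + 1) + 37))) fun a => ?_
  set I := inst a
  set N := I.encode.length with hN
  have hNn : I.n + I.m ≤ N := by
    rw [hN, I.encode_eq]
    simp [unary]
    lia
  have hn : I.n ≤ N := by lia
  have hm : I.m ≤ N := by lia
  have h₁ := run_readInstance I hτ hN.ge
  have e₁ : { (I.header : St ι) with toks := (I.toks τ).reverse } =
      I.work τ I.header (fun _ => false) fun _ => false := by
    unfold SimpleInstance.work
    rw [List.map_reverse]
    rfl
  rw [e₁] at h₁
  obtain ⟨o, i, A, hA, hAl, h₂⟩ := exists_run_checkKinds I τ φ Q Finset.univ.toList I.header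
    (fun _ => false) (fun _ => false) rfl rfl rfl rfl rfl rfl
  rw [Finset.length_toList, Finset.card_univ, ← hc] at h₂ hAl
  have ht := I.length_toks_le τ
  have hM : I.n * (I.m * (I.n + 1) + 1) ≤ N * (N * (N + 1) + 1) := by gcongr
  have h₃ := run_output (M := N * (N * (N + 1) + 1) + N + c + 1)
    (I.work τ { I.header with ans := A } o i)
    (fun k => by
      cases k
      case n₁ => exact List.length_replicate.trans_le (by lia)
      case n₂ => exact List.length_replicate.trans_le (by lia)
      case m => exact List.length_replicate.trans_le (by lia)
      case ini => exact List.length_replicate.trans_le (by have := I.init.2; lia)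
      case toks => exact (I.toks τ).length_reverse.trans_le (ht.trans (by lia))
      case cells =>
        refine (List.length_map _).trans_le ?_
        rw [List.length_reverse, List.length_finRange]
        lia
      case ans => exact hAl.trans (by change 0 + c ≤ _; lia)
      all_goals exact Nat.zero_le _)
    (by lia) rfl
  refine ⟨!A.isEmpty, ?_, ?_⟩
  · rw [Bool.not_eq_true', ← Bool.not_eq_true, List.isEmpty_iff, hA]
    simp [SimpleInstance.header]
  · have h := h₁.seq (h₂.seq h₃)
    have e : ({} : St ι).get = fun _ => [] := by
      funext k
      cases k <;> rfl
    rw [← e, St.update_get, St.update_get]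
    have e₂ : I.encode.map (Equiv.refl Symbol).symm = I.encode := List.map_id _
    change Run _ { inp := I.encode.map (Equiv.refl Symbol).symm } { out := [!A.isEmpty] } _
    rw [e₂]
    refine h.mono ?_
    simp only [Polynomial.eval_add, Polynomial.eval_mul, Polynomial.eval_X, Polynomial.eval_ofNat,
      Polynomial.eval_natCast, Polynomial.eval_one, Nat.cast_id]
    gcongr

end ParamMDP

theorem mainTheorem5 :
    -- graph-preserving valuations: all qualitative reachability problems
    (∀ (Q : ParamMDP.Quantifier) (φ : ParamMDP.Qualitative),
      ParamMDP.PolyTimeDecidable ParamMDP.SimpleInstance.encode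
        (fun I => I.toPMDP.Reach (I.target : Set (Fin I.n)) I.toPMDP.gpVal Q φ)) ∧
    -- positive reachability for all sets of valuations that include the graph-preserving ones
    (∀ (Q : ParamMDP.Quantifier) (R : ∀ I : ParamMDP.SimpleInstance, Set (Fin I.k → ℝ)),
      (∀ I, I.toPMDP.gpVal ⊆ R I ∧ R I ⊆ I.toPMDP.wdVal) →
      ParamMDP.PolyTimeDecidable ParamMDP.SimpleInstance.encode
        (fun I => I.toPMDP.Reach (I.target : Set (Fin I.n)) (R I) Q .positive)) ∧
    -- at most `K` parameters, for a fixed `K`: all qualitative reachability problems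
    (∀ (K : ℕ) (c : ParamMDP.ValClass) (Q : ParamMDP.Quantifier) (φ : ParamMDP.Qualitative),
      ParamMDP.PolyTimeDecidable
        (fun I : {I : ParamMDP.SimpleInstance // I.k ≤ K} => I.1.encode)
        (fun I => I.1.toPMDP.Reach (I.1.target : Set (Fin I.1.n)) (I.1.toPMDP.vals c) Q φ)) ∧
    -- partition of the well-defined valuations into at most `3 ^ |X|` graph-consistent sets
    (∀ (S A X : Type*) [Fintype S] [Fintype A] [Fintype X] (M : ParamMDP.PMDP S A X),
      M.IsSimple →
      ∃ 𝓡 : Finset (Set (X → ℝ)), 𝓡.card ≤ 3 ^ Fintype.card X ∧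
        (∀ R ∈ 𝓡, R.Nonempty ∧ M.IsMaxGraphConsistent R) ∧
        (𝓡 : Set (Set (X → ℝ))).PairwiseDisjoint id ∧
        ⋃₀ (𝓡 : Set (Set (X → ℝ))) = M.wdVal) := by
  open ParamMDP SimpleInstance in
  -- for graph-preserving valuations, a single choice of kinds has to be considered
  have gp : ∀ {α : Type} (inst : α → SimpleInstance) (Q : Quantifier) (φ : Qualitative),
      PolyTimeDecidable (fun a => (inst a).encode)
        fun a => (inst a).answer Q φ (fun _ => none) = true := by
    intro α inst Q φ
    have h := polyTimeDecidable_exists_answer (ι := Unit) (K := 0) (τ := fun _ _ => none)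
      (fun _ _ _ => rfl) inst Q φ
    simpa only [exists_const] using h
  refine ⟨fun Q φ => ?_, fun Q R hR => ?_, fun K c Q φ => ?_, fun S A X _ _ _ M hM =>
    PMDP.exists_partition hM⟩
  · exact (gp id Q φ).congr fun I => reach_gpVal_iff Q φ
  · exact (gp id Q .positive).congr fun I => reach_positive_iff (hR I).1 Q
  · cases c with
    | graphPreserving => exact (gp Subtype.val Q φ).congr fun I => reach_gpVal_iff Q φ
    | wellDefined =>
      exact (polyTimeDecidable_exists_answer (fun τ z hz => extendKind_of_le τ hz) Subtype.val Q
        φ).congr fun I => reach_wdVal_iff I.2 Q φ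
    | boolean =>
      exact (polyTimeDecidable_exists_answer
        (τ := fun (τ : Fin K → Bool) => extendKind fun x => some (τ x))
        (fun τ z hz => extendKind_of_le _ hz) Subtype.val Q φ).congr
          fun I => reach_boolVal_iff I.2 Q φ
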